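/- For $\theta$ on the circle $\mathbb R/2\pi\mathbb Z$ put $$a_0=\tfrac{1-\cos\theta+\sin\theta}{2\sqrt2},\quad a_1=\tfrac{1-\cos\theta-\sin\theta}{2\sqrt2},\quad a_2=\tfrac{1+\cos\theta-\sin\theta}{2\sqrt2},\quad a_3=\tfrac{1+\cos\theta+\sin\theta}{2\sqrt2},$$ $m_0(z)=\sum_{k=0}^3a_kz^k$ and $m_1(z)=\sum_{k=0}^3(-1)^ka_{3-k}z^k$, and let $(S_i\xi)(z)=m_i(z)\,\xi(z^2)$, $i=0,1$, on $L^2(\mathbb T)$ (normalized Haar measure). Then $S_i^*S_j=\delta_{ij}1$ and $S_0S_0^*+S_1S_1^*=1$, so $s_i\mapsto S_i$ defines a representation $\pi^{(\theta)}$ of the Cuntz algebra $\mathcal O_2$. With $e_n(z)=z^n$, the space $\mathcal K=\operatorname{span}\{e_0,e_{-1},e_{-2},e_{-3}\}$ is invariant under $S_0^*,S_1^*$, and relative to this basis $V_i^*:=S_i^*|_{\mathcal K}$ has the matrices $$V_0^*=\begin{pmatrix}a_0&0&0&0\\a_2&a_1&a_0&0\\0&a_3&a_2&a_1\\0&0&0&a_3\end{pmatrix},\qquad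 V_1^*=\begin{pmatrix}a_3&0&0&0\\a_1&-a_2&a_3&0\\0&-a_0&a_1&-a_2\\0&0&0&-a_0\end{pmatrix}.$$ For $\theta,\varphi$ on the circle let $V_i$ belong to $\theta$ and $W_i$ to $\varphi$, and define $\rho(A)=\sum_{i=0}^1W_iAV_i^*$ on $M_4(\mathbb C)$; write $\sigma$ for $\rho$ when $\varphi=\theta$. Then: 1. For every $\theta$ the eigenvalues of $\sigma$, with algebraic multiplicity, are $1$ (once), $0$ ($8$ times), $\frac{\cos\theta}2$ (twice), $-\frac{\cos\theta}2$ (twice), $\frac{1+\sin\theta}2$ (twice), $-\sin\theta$ (once), where multiplicities are added when values coincide. 2. The fixed-point space $\{A:\sigma(A)=A\}$ has dimension $3$ if $\theta=\frac\pi2$, $2$ if $\theta=\frac{3\pi}2$, and $1$ otherwise, and for every $\theta$ this is also the dimension of the commutant of $\pi^{(\theta)}(\mathcal O_2)$. 3. $\pi^{(\theta)}$ is irreducible for $\theta\notin\{\frac\pi2,\frac{3\pi}2\}$; it is an orthogonal direct sum of $2$ mutually inequivalent irreducible representations for $\theta=\frac{3\pi}2$ and of $3$ mutually inequivalent irreducible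 representations for $\theta=\frac\pi2$. 4. The only eigenvalue of $\sigma$ of modulus $1$ is $1$ if $\theta\ne\frac\pi2$; for $\theta=\frac\pi2$ the eigenvalues of modulus $1$ are exactly $1$ and $-1$, and the eigenspace for $-1$ has dimension $1$. 5. For $\theta\notin\{\frac\pi2,\frac{3\pi}2\}$ the restriction of $\pi^{(\theta)}$ to $\mathrm{UHF}_2$ (the fixed-point algebra of the gauge action $s_i\mapsto ts_i$, $|t|=1$, i.e. the closed linear span of the monomials $s_Is_J^*$ with $|I|=|J|$) is irreducible. 6. If $\theta\neq\varphi$, then $1$ is an eigenvalue of $\rho$ if and only if $\{\theta,\varphi\}=\{\frac\pi2,\frac{3\pi}2\}$. In that exceptional case the eigenspace of $\rho$ for $1$ and the space of bounded operators $U$ on $L^2(\mathbb T)$ with $U\pi^{(\theta)}(s_i)=\pi^{(\varphi)}(s_i)U$ for $i=0,1$ both have dimension $2$. If $\theta\ne\varphi$ and $\{\theta,\varphi\}\ne\{\frac\pi2,\frac{3\pi}2\}$, the only such operator is $U=0$, i.e. $\pi^{(\theta)}$ and $\pi^{(\varphi)}$ are disjoint; in particular the representations at distinct points outside $\{\frac\pi2,\frac{3\pi}2\}$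 are mutually disjoint. -/

import Mathlib

/-! ### Representations of the Cuntz algebra `𝒪_N` on Hilbert spaces

`𝒪_N` is the universal `C*`-algebra generated by `s_0, …, s_{N-1}` subject to the Cuntz relations,
so a representation of `𝒪_N` on a Hilbert space `H` is the same thing as a family of bounded
operators `S_0, …, S_{N-1}` on `H` that satisfies these relations. -/

namespace CuntzRep

variable {N : ℕ} {H K : Type*}
  [NormedAddCommGroup H] [InnerProductSpace ℂ H] [CompleteSpace H]
  [NormedAddCommGroup K] [InnerProductSpace ℂ K] [CompleteSpace K]

/-- The Cuntz relations `S_i^* S_j = δ_{ij} 1`, `∑ S_i S_i^* = 1`: the family `S` is (the family of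
images of the generators under) a representation of `𝒪_N` on `H`. -/
def IsCuntzFamily (S : Fin N → H →L[ℂ] H) : Prop :=
  (∀ i j, star (S i) * S j = if i = j then 1 else 0) ∧ ∑ i, S i * star (S i) = 1

/-- The image `π(𝒪_N)` of the Cuntz algebra: the `C*`-algebra generated by the `S_i`. -/
def cuntzImage (S : Fin N → H →L[ℂ] H) : Set (H →L[ℂ] H) :=
  (StarAlgebra.adjoin ℂ (Set.range S)).topologicalClosure

/-- The monomial `S_I = S_{i_1} ⋯ S_{i_k}` of a word `I = (i_1, …, i_k)`. -/
def monomial (S : Fin N → H →L[ℂ] H) (I : List (Fin N)) : H →L[ℂ] H :=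
  (I.map S).prod

/-- The image `π(UHF_N)` of the fixed point algebra of the gauge action: the closed linear span of
the Wick ordered monomials `S_I S_J^*` with `|I| = |J|`. -/
def uhfImage (S : Fin N → H →L[ℂ] H) : Set (H →L[ℂ] H) :=
  (Submodule.span ℂ {T | ∃ I J : List (Fin N), I.length = J.length ∧
    T = monomial S I * star (monomial S J)}).topologicalClosure

/-- The subspace `M` is invariant under every operator in `𝒜`. -/
def IsInvariant (𝒜 : Set (H →L[ℂ] H)) (M : Submodule ℂ H) : Prop :=
  ∀ T ∈ 𝒜, ∀ x ∈ M, T x ∈ M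

/-- `M` is a nonzero closed `𝒜`-invariant subspace on which `𝒜` acts irreducibly: the only closed
`𝒜`-invariant subspaces of `M` are `0` and `M`. -/
def IsIrreducibleOn (𝒜 : Set (H →L[ℂ] H)) (M : Submodule ℂ H) : Prop :=
  M ≠ ⊥ ∧ IsClosed (M : Set H) ∧ IsInvariant 𝒜 M ∧
    ∀ L : Submodule ℂ H, L ≤ M → IsClosed (L : Set H) → IsInvariant 𝒜 L → L = ⊥ ∨ L = M

/-- `𝒜` acts irreducibly on the whole Hilbert space. -/
def ActsIrreducibly (𝒜 : Set (H →L[ℂ] H)) : Prop :=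
  IsIrreducibleOn 𝒜 ⊤

/-- The restrictions of `𝒜` to the invariant subspaces `M` and `M'` are unitarily equivalent. -/
def AreEquivalentOn (𝒜 : Set (H →L[ℂ] H)) (M M' : Submodule ℂ H) : Prop :=
  ∃ U : M ≃ₗᵢ[ℂ] M', ∀ T ∈ 𝒜, ∀ x y : M, T (x : H) = (y : H) → T (U x : H) = (U y : H)

/-- `H` is the orthogonal direct sum of `k` mutually inequivalent irreducible subrepresentations. -/
def SplitsIntoInequivalentIrreducibles (𝒜 : Set (H →L[ℂ] H)) (k : ℕ) : Prop :=
  ∃ M : Fin k → Submodule ℂ H,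
    (∀ j, IsIrreducibleOn 𝒜 (M j)) ∧
    (∀ j l, j ≠ l → M j ⟂ M l) ∧
    (⨆ j, M j) = ⊤ ∧
    ∀ j l, j ≠ l → ¬ AreEquivalentOn 𝒜 (M j) (M l)

/-- The commutant `𝒜'`, as a linear subspace of `B(H)`. -/
def commutant (𝒜 : Set (H →L[ℂ] H)) : Submodule ℂ (H →L[ℂ] H) :=
  Subalgebra.toSubmodule (Subalgebra.centralizer ℂ 𝒜)

/-- The space of intertwiners between two representations of `𝒪_N`: the bounded operators
`U : H → K` with `U S_i = T_i U` for all `i`. (For families satisfying the Cuntz relations this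
implies `U S_i^* = T_i^* U`.) -/
def intertwiners (S : Fin N → H →L[ℂ] H) (T : Fin N → K →L[ℂ] K) : Submodule ℂ (H →L[ℂ] K) where
  carrier := {U | ∀ i, U ∘L S i = T i ∘L U}
  add_mem' := by
    intro U V hU hV i
    rw [ContinuousLinearMap.add_comp, ContinuousLinearMap.comp_add, hU i, hV i]
  zero_mem' := by
    intro i
    rw [ContinuousLinearMap.zero_comp, ContinuousLinearMap.comp_zero]
  smul_mem' := by
    intro c U hU i
    rw [ContinuousLinearMap.smul_comp, ContinuousLinearMap.comp_smul, hU i]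

/-- Two representations of `𝒪_N` are disjoint if there is no nonzero intertwiner. -/
def AreDisjoint (S : Fin N → H →L[ℂ] H) (T : Fin N → K →L[ℂ] K) : Prop :=
  intertwiners S T = ⊥

end CuntzRep

/-! ### The genus-2 filters and their representations of `𝒪_2` on `L²(𝕋)` -/

namespace GenusTwo

open MeasureTheory

noncomputable section

/-- `L²(𝕋)` with respect to normalized Haar measure; a point of `𝕋` is written `x ∈ ℝ/ℤ`, the
corresponding complex number of modulus one being `z = e^{2πix}`. The monomial `z^n` is
`fourier n`. -/
abbrev L2T : Type := Lp ℂ 2 (AddCircle.haarAddCircle (T := (1 : ℝ)))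

/-- The Fourier basis vector `e_n(z) = z^n`, as an element of `L²(𝕋)`. -/
abbrev e (n : ℤ) : L2T := fourierLp (T := (1 : ℝ)) 2 n

theorem measurePreserving_double :
    MeasurePreserving (fun x : UnitAddCircle ↦ (2 : ℤ) • x)
      AddCircle.haarAddCircle AddCircle.haarAddCircle :=
  Measure.measurePreserving_zsmul _ (by norm_num)

/-- The operator `(S ξ)(z) = m(z) ξ(z²)` on `L²(𝕋)` attached to a continuous function `m`. -/
def filterOp (m : C(UnitAddCircle, ℂ)) : L2T →L[ℂ] L2T :=
  LinearMap.mkContinuous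
    { toFun := fun ξ ↦ (ContinuousMap.toLp ⊤ AddCircle.haarAddCircle ℂ m) •
        (Lp.compMeasurePreservingₗᵢ ℂ _ measurePreserving_double ξ : L2T)
      map_add' := by
        intro ξ η
        rw [map_add]
        exact Lp.add_smul _ _ _
      map_smul' := by
        intro c ξ
        rw [map_smul, RingHom.id_apply]
        exact (Lp.smul_comm _ _ _).symm }
    ‖ContinuousMap.toLp (E := ℂ) ⊤ (AddCircle.haarAddCircle (T := (1 : ℝ))) ℂ m‖
    (by
      intro ξ
      refine (Lp.norm_smul_le _ _).trans_eq ?_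
      rw [LinearIsometry.norm_map])

theorem filterOp_ae (m : C(UnitAddCircle, ℂ)) (ξ : L2T) :
    filterOp m ξ =ᵐ[AddCircle.haarAddCircle] fun x ↦ m x * ξ ((2 : ℤ) • x) := by
  have h1 := Lp.coeFn_lpSMul (r := 2) (ContinuousMap.toLp (E := ℂ) ⊤
    (AddCircle.haarAddCircle (T := (1 : ℝ))) ℂ m)
    (Lp.compMeasurePreservingₗᵢ ℂ _ measurePreserving_double ξ : L2T)
  have h2 := ContinuousMap.coeFn_toLp (E := ℂ) (p := ⊤) (𝕜 := ℂ)
    (AddCircle.haarAddCircle (T := (1 : ℝ))) m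
  have h3 := Lp.coeFn_compMeasurePreserving ξ measurePreserving_double
  refine h1.trans ?_
  filter_upwards [h2, h3] with x hx2 hx3
  rw [Pi.smul_apply', hx2, smul_eq_mul]
  exact congrArg _ hx3

/-- The low-pass coefficients `a_0, a_1, a_2, a_3` at the point `θ` of the circle. -/
def lowCoeff (θ : Real.Angle) : Fin 4 → ℝ :=
  ![(1 - θ.cos + θ.sin) / (2 * √2), (1 - θ.cos - θ.sin) / (2 * √2),
    (1 + θ.cos - θ.sin) / (2 * √2), (1 + θ.cos + θ.sin) / (2 * √2)]

/-- The high-pass coefficients `(-1)^k a_{3-k}`. -/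
def highCoeff (θ : Real.Angle) (k : Fin 4) : ℝ :=
  (-1) ^ (k : ℕ) * lowCoeff θ k.rev

/-- The polynomial `m(z) = ∑ c_k z^k`, `k = 0, …, 3`, as a function on the circle. -/
def filterPoly (c : Fin 4 → ℝ) : C(UnitAddCircle, ℂ) :=
  ∑ k : Fin 4, (c k : ℂ) • fourier (k : ℤ)

/-- The representation `π^(θ)` of `𝒪_2` on `L²(𝕋)`: `(S_i ξ)(z) = m_i(z) ξ(z²)` with
`m_0(z) = ∑ a_k z^k` and `m_1(z) = ∑ (-1)^k a_{3-k} z^k`. -/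
def rep (θ : Real.Angle) : Fin 2 → L2T →L[ℂ] L2T :=
  ![filterOp (filterPoly (lowCoeff θ)), filterOp (filterPoly (highCoeff θ))]

/-- The matrices of `V_0^*` and `V_1^*` relative to the basis `e_0, e_{-1}, e_{-2}, e_{-3}` of
`𝒦 = span {e_{-3}, …, e_0}`, for filter coefficients `a`. -/
def slantToeplitz (a : Fin 4 → ℝ) : Matrix (Fin 4) (Fin 4) ℂ :=
  !![(a 0 : ℂ), 0, 0, 0;
     (a 2 : ℂ), (a 1 : ℂ), (a 0 : ℂ), 0;
     0, (a 3 : ℂ), (a 2 : ℂ), (a 1 : ℂ);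
     0, 0, 0, (a 3 : ℂ)]

/-- `V_i^*` at the point `θ`. -/
def Vstar (θ : Real.Angle) : Fin 2 → Matrix (Fin 4) (Fin 4) ℂ :=
  ![slantToeplitz (lowCoeff θ), slantToeplitz (highCoeff θ)]

open scoped Matrix in
/-- The map `ρ(A) = ∑ W_i A V_i^*` on `M_4(ℂ)`, where the `V_i` belong to `θ` and the `W_i` to
`φ`. -/
def rho (θ φ : Real.Angle) :
    Matrix (Fin 4) (Fin 4) ℂ →ₗ[ℂ] Matrix (Fin 4) (Fin 4) ℂ where
  toFun A := ∑ i : Fin 2, (Vstar φ i)ᴴ * A * Vstar θ i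
  map_add' := by
    intro A B
    simp only [mul_add, add_mul, Finset.sum_add_distrib]
  map_smul' := by
    intro c A
    simp only [Matrix.mul_smul, Matrix.smul_mul, Finset.smul_sum, RingHom.id_apply]

/-- The map `σ(A) = ∑ V_i A V_i^*` on `M_4(ℂ)`. -/
def sigma (θ : Real.Angle) : Matrix (Fin 4) (Fin 4) ℂ →ₗ[ℂ] Matrix (Fin 4) (Fin 4) ℂ :=
  rho θ θ

/-- The point `θ = π/2` of the circle. -/
def north : Real.Angle := ((Real.pi / 2 : ℝ) : Real.Angle)

/-- The point `θ = 3π/2` of the circle. -/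
def south : Real.Angle := ((3 * Real.pi / 2 : ℝ) : Real.Angle)

end

end GenusTwo

namespace GenusTwo

noncomputable section

/-- The correlation matrix `∑ᵢ mᵢ(φ)_j mᵢ(θ)_k` of the filter coefficients at `φ` and at `θ`. -/
def corr (θ φ : Real.Angle) (j k : Fin 4) : ℝ :=
  lowCoeff φ j * lowCoeff θ k + highCoeff φ j * highCoeff θ k

theorem highCoeff_eq (θ : Real.Angle) : highCoeff θ =
    ![(1 + θ.cos + θ.sin) / (2 * √2), (-1 - θ.cos + θ.sin) / (2 * √2),
      (1 - θ.cos - θ.sin) / (2 * √2), (-1 + θ.cos - θ.sin) / (2 * √2)] := by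
  ext k
  fin_cases k <;> simp [highCoeff, lowCoeff, Fin.rev] <;> ring

theorem div_two_sqrt_two_mul (x y : ℝ) : x / (2 * √2) * (y / (2 * √2)) = x * y / 8 := by
  rw [div_mul_div_comm, mul_mul_mul_comm, Real.mul_self_sqrt (by norm_num)]
  norm_num

theorem rho_apply (θ φ : Real.Angle) (A : Matrix (Fin 4) (Fin 4) ℂ) (r c : Fin 4) :
    rho θ φ A r c =
      corr θ φ (![0, 1, 0, 1] r) (![0, 1, 0, 1] c) * A (![0, 1, 1, 2] r) (![0, 1, 1, 2] c) +
      corr θ φ (![0, 1, 0, 1] r) (![2, 3, 2, 3] c) * A (![0, 1, 1, 2] r) (![1, 2, 2, 3] c) +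
      corr θ φ (![2, 3, 2, 3] r) (![0, 1, 0, 1] c) * A (![1, 2, 2, 3] r) (![0, 1, 1, 2] c) +
      corr θ φ (![2, 3, 2, 3] r) (![2, 3, 2, 3] c) * A (![1, 2, 2, 3] r) (![1, 2, 2, 3] c) := by
  simp only [rho, LinearMap.coe_mk, AddHom.coe_mk, Fin.sum_univ_two, Matrix.add_apply,
    Matrix.mul_apply, Fin.sum_univ_four, Matrix.conjTranspose_apply, corr, Vstar, slantToeplitz]
  fin_cases r <;> fin_cases c <;> simp <;> ring

theorem corr_eq (θ φ : Real.Angle) (j k : Fin 4) : corr θ φ j k =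
    (!![1 + (θ.cos * φ.cos + θ.sin * φ.sin) + θ.sin + φ.sin,
        (θ.sin * φ.cos - θ.cos * φ.sin) - θ.cos - φ.cos,
        1 - (θ.cos * φ.cos + θ.sin * φ.sin) - θ.sin + φ.sin,
        -(θ.sin * φ.cos - θ.cos * φ.sin) + θ.cos - φ.cos;
        -(θ.sin * φ.cos - θ.cos * φ.sin) - θ.cos - φ.cos,
        1 + (θ.cos * φ.cos + θ.sin * φ.sin) - θ.sin - φ.sin,
        (θ.sin * φ.cos - θ.cos * φ.sin) + θ.cos - φ.cos,
        1 - (θ.cos * φ.cos + θ.sin * φ.sin) + θ.sin - φ.sin;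
        1 - (θ.cos * φ.cos + θ.sin * φ.sin) + θ.sin - φ.sin,
        -(θ.sin * φ.cos - θ.cos * φ.sin) - θ.cos + φ.cos,
        1 + (θ.cos * φ.cos + θ.sin * φ.sin) - θ.sin - φ.sin,
        (θ.sin * φ.cos - θ.cos * φ.sin) + θ.cos + φ.cos;
        (θ.sin * φ.cos - θ.cos * φ.sin) - θ.cos + φ.cos,
        1 - (θ.cos * φ.cos + θ.sin * φ.sin) - θ.sin + φ.sin,
        -(θ.sin * φ.cos - θ.cos * φ.sin) + θ.cos + φ.cos,
        1 + (θ.cos * φ.cos + θ.sin * φ.sin) + θ.sin + φ.sin] : Matrix (Fin 4) (Fin 4) ℝ) j k / 4 := by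
  fin_cases j <;> fin_cases k <;>
    simp [corr, highCoeff_eq, lowCoeff, div_two_sqrt_two_mul] <;> ring

theorem corr_self (θ : Real.Angle) (j k : Fin 4) : corr θ θ j k =
    (!![(1 + θ.sin) / 2, -(θ.cos / 2), 0, 0;
        -(θ.cos / 2), (1 - θ.sin) / 2, 0, 0;
        0, 0, (1 - θ.sin) / 2, θ.cos / 2;
        0, 0, θ.cos / 2, (1 + θ.sin) / 2] : Matrix (Fin 4) (Fin 4) ℝ) j k := by
  have h := Real.Angle.cos_sq_add_sin_sq θ
  rw [corr_eq]
  fin_cases j <;> fin_cases k <;> simp <;> linarith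

/-- Coordinates on `M₄(ℂ)` in which `σ` is upper triangular. -/
def triangularCoords : Matrix (Fin 4) (Fin 4) ℂ ≃ₗ[ℂ] (Fin 16 → ℂ) where
  toFun A := ![A 0 0, A 3 3, A 0 3, A 3 0, A 0 2, A 0 1, A 2 0, A 1 0, A 3 1, A 3 2, A 1 3, A 2 3,
    A 1 2, A 2 1, A 1 1 - A 2 2, A 1 1 + A 2 2]
  map_add' A B := by
    ext i; fin_cases i <;> simp <;> ring
  map_smul' t A := by
    ext i; fin_cases i <;> simp <;> ring
  invFun v := !![v 0, v 5, v 4, v 2; v 7, (v 14 + v 15) / 2, v 12, v 10;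
    v 6, v 13, (v 15 - v 14) / 2, v 11; v 3, v 8, v 9, v 1]
  left_inv A := by
    ext i j; fin_cases i <;> fin_cases j <;> simp
  right_inv v := by
    ext i; fin_cases i <;> simp <;> ring

theorem triangularCoords_sigma_symm (θ : Real.Angle) (v : Fin 16 → ℂ) :
    triangularCoords (sigma θ (triangularCoords.symm v)) =
      ![(1 + θ.sin) / 2 * v 0 + (1 - θ.sin) / 4 * (v 15 + v 14),
        (1 + θ.sin) / 2 * v 1 + (1 - θ.sin) / 4 * (v 15 - v 14),
        θ.cos / 2 * (v 10 - v 4), θ.cos / 2 * (v 8 - v 6),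
        (1 + θ.sin) / 2 * v 5 + (1 - θ.sin) / 2 * v 12, θ.cos / 2 * (v 12 - v 5),
        (1 + θ.sin) / 2 * v 7 + (1 - θ.sin) / 2 * v 13, θ.cos / 2 * (v 13 - v 7),
        (1 + θ.sin) / 2 * v 9 + (1 - θ.sin) / 2 * v 13, θ.cos / 2 * (v 9 - v 13),
        (1 + θ.sin) / 2 * v 11 + (1 - θ.sin) / 2 * v 12, θ.cos / 2 * (v 11 - v 12),
        -(θ.cos / 2) * v 14, -(θ.cos / 2) * v 14, -θ.sin * v 14, v 15] := by
  ext i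
  fin_cases i <;> simp [triangularCoords, sigma, rho_apply, corr_self] <;> ring

open Polynomial in
theorem charpoly_sigma (θ : Real.Angle) : (sigma θ).charpoly =
    (X - C 1) * X ^ 8 * (X - C ((θ.cos / 2 : ℝ) : ℂ)) ^ 2 * (X - C ((-(θ.cos / 2) : ℝ) : ℂ)) ^ 2 *
      (X - C (((1 + θ.sin) / 2 : ℝ) : ℂ)) ^ 2 * (X - C ((-θ.sin : ℝ) : ℂ)) := by
  let M : Matrix (Fin 16) (Fin 16) ℂ := LinearMap.toMatrix' (triangularCoords.conj (sigma θ))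
  have hM (i j : Fin 16) : M i j =
      triangularCoords (sigma θ (triangularCoords.symm (Pi.single j 1))) i := by
    simp only [M, LinearMap.toMatrix'_apply, LinearEquiv.conj_apply_apply]
  have htri : M.BlockTriangular id := by
    intro i j hij
    rw [hM, triangularCoords_sigma_symm]
    revert hij
    fin_cases j <;> fin_cases i <;> intro hij <;> first
      | exact absurd hij (by decide)
      | simp
  rw [← LinearEquiv.charpoly_conj triangularCoords, ← LinearMap.charpoly_toMatrix _ (Pi.basisFun ℂ _)]
  change M.charpoly = _
  rw [Matrix.charpoly_of_isUpperTriangular _ htri]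
  have hd : (fun i ↦ M i i) = ![((1 + θ.sin) / 2 : ℂ), (1 + θ.sin) / 2, 0, 0, 0, -(θ.cos / 2), 0,
      -(θ.cos / 2), 0, θ.cos / 2, 0, θ.cos / 2, 0, 0, -θ.sin, 1] := by
    ext i
    rw [hM, triangularCoords_sigma_symm]
    fin_cases i <;> simp
  have hd' (i) : M i i = _ := congrFun hd i
  simp only [hd', Fin.prod_univ_succ]
  simp
  ring

theorem north_cos : north.cos = 0 := by simp [north]

theorem north_sin : north.sin = 1 := by simp [north]

theorem south_cos : south.cos = 0 := by
  rw [south, Real.Angle.cos_coe, show 3 * Real.pi / 2 = Real.pi / 2 + Real.pi by ring,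
    Real.cos_add_pi, Real.cos_pi_div_two, neg_zero]

theorem south_sin : south.sin = -1 := by
  rw [south, Real.Angle.sin_coe, show 3 * Real.pi / 2 = Real.pi / 2 + Real.pi by ring,
    Real.sin_add_pi, Real.sin_pi_div_two]

theorem eq_of_cos_eq_of_sin_eq {θ φ : Real.Angle} (hc : θ.cos = φ.cos) (hs : θ.sin = φ.sin) :
    θ = φ := by
  rw [← Real.Angle.coe_toReal θ, ← Real.Angle.coe_toReal φ] at hc hs ⊢
  exact Real.Angle.cos_sin_inj hc hs

theorem eq_north_of_sin {θ : Real.Angle} (h : θ.sin = 1) : θ = north := by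
  have := Real.Angle.cos_sq_add_sin_sq θ
  refine eq_of_cos_eq_of_sin_eq ?_ (by rw [h, north_sin])
  rw [north_cos]
  exact pow_eq_zero_iff two_ne_zero |>.1 (by rw [h] at this; linarith)

theorem eq_south_of_sin {θ : Real.Angle} (h : θ.sin = -1) : θ = south := by
  have := Real.Angle.cos_sq_add_sin_sq θ
  refine eq_of_cos_eq_of_sin_eq ?_ (by rw [h, south_sin])
  rw [south_cos]
  exact pow_eq_zero_iff two_ne_zero |>.1 (by rw [h] at this; linarith)

/-! ### The fixed points of `σ` -/

theorem finrank_eq_of_forall_mem_iff_diagonal {k : ℕ}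
    (E : Submodule ℂ (Matrix (Fin 4) (Fin 4) ℂ)) (g : Fin 4 → Fin k) (hg : Function.Surjective g)
    (h : ∀ A, A ∈ E ↔ ∃ v : Fin k → ℂ, Matrix.diagonal (v ∘ g) = A) :
    Module.finrank ℂ E = k := by
  have hE : E = LinearMap.range
      ((Matrix.diagonalLinearMap (Fin 4) ℂ ℂ) ∘ₗ LinearMap.funLeft ℂ ℂ g) := by
    ext A
    rw [h, LinearMap.mem_range]
    rfl
  rw [hE, LinearMap.finrank_range_of_inj, Module.finrank_fin_fun]
  exact (Matrix.diagonal_injective).comp (LinearMap.funLeft_injective_of_surjective _ _ _ hg)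

theorem sigma_eq_self_iff {θ : Real.Angle} (hn : θ ≠ north) (hs : θ ≠ south)
    (A : Matrix (Fin 4) (Fin 4) ℂ) : sigma θ A = A ↔ A = A 0 0 • 1 := by
  constructor
  · intro h
    have h (r c) : A r c = _ := (congrFun (congrFun h r) c).symm.trans (rho_apply θ θ A r c)
    have h1 : (1 + (θ.sin : ℂ)) ≠ 0 := by
      intro h0
      have h0 : (1 + θ.sin : ℝ) = 0 := mod_cast h0
      exact hs (eq_south_of_sin (by linarith))
    have h2 : (1 - (θ.sin : ℂ)) ≠ 0 := by
      intro h0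
      have h0 : (1 - θ.sin : ℝ) = 0 := mod_cast h0
      exact hn (eq_north_of_sin (by linarith))
    have hcs (ε : ℝ) (hε : |ε| = 1) : (1 - (ε * θ.cos / 2 : ℂ)) ≠ 0 := by
      intro h0
      have h3 : (1 - ε * θ.cos / 2 : ℝ) = 0 := mod_cast h0
      have h4 : |θ.cos| ≤ 1 := by
        rw [← sq_le_one_iff_abs_le_one]
        nlinarith [Real.Angle.cos_sq_add_sin_sq θ]
      have h5 : |ε * θ.cos| = 2 := by
        rw [show ε * θ.cos = 2 by linarith]; norm_num
      rw [abs_mul, hε] at h5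
      linarith
    have hc1 := hcs 1 (by norm_num)
    have hc2 := hcs (-1) (by norm_num)
    simp only [Complex.ofReal_one, Complex.ofReal_neg] at hc1 hc2
    have e00 := h 0 0
    have e01 := h 0 1
    have e02 := h 0 2
    have e03 := h 0 3
    have e10 := h 1 0
    have e11 := h 1 1
    have e12 := h 1 2
    have e13 := h 1 3
    have e20 := h 2 0
    have e21 := h 2 1
    have e22 := h 2 2
    have e23 := h 2 3
    have e30 := h 3 0
    have e31 := h 3 1
    have e32 := h 3 2
    have e33 := h 3 3
    simp [corr_self] at e00 e01 e02 e03 e10 e11 e12 e13 e20 e21 e22 e23 e30 e31 e32 e33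
    have hy : A 1 1 - A 2 2 = 0 := (mul_eq_zero_iff_left h1).1 (by linear_combination e11 - e22)
    have k12 : A 1 2 = 0 := by linear_combination e12 - θ.cos / 2 * hy
    have k21 : A 2 1 = 0 := by linear_combination e21 - θ.cos / 2 * hy
    have k01 : A 0 1 = 0 := (mul_eq_zero_iff_left hc2).1 (by
      linear_combination e01 + θ.cos / 2 * k12)
    have k10 : A 1 0 = 0 := (mul_eq_zero_iff_left hc2).1 (by
      linear_combination e10 + θ.cos / 2 * k21)
    have k23 : A 2 3 = 0 := (mul_eq_zero_iff_left hc1).1 (by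
      linear_combination e23 - θ.cos / 2 * k12)
    have k32 : A 3 2 = 0 := (mul_eq_zero_iff_left hc1).1 (by
      linear_combination e32 - θ.cos / 2 * k21)
    rw [k01, k12] at e02
    rw [k10, k21] at e20
    rw [k32, k21] at e31
    rw [k23, k12] at e13
    have k02 : A 0 2 = 0 := by linear_combination e02
    have k20 : A 2 0 = 0 := by linear_combination e20
    have k31 : A 3 1 = 0 := by linear_combination e31
    have k13 : A 1 3 = 0 := by linear_combination e13
    have k03 : A 0 3 = 0 := by linear_combination e03 - θ.cos / 2 * k02 + θ.cos / 2 * k13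
    have k30 : A 3 0 = 0 := by linear_combination e30 - θ.cos / 2 * k20 + θ.cos / 2 * k31
    have k00 : A 1 1 - A 0 0 = 0 := (mul_eq_zero_iff_left h2).1 (by linear_combination -2 * e00)
    have k33 : A 2 2 - A 3 3 = 0 := (mul_eq_zero_iff_left h2).1 (by linear_combination -2 * e33)
    ext i j
    fin_cases i <;> fin_cases j <;>
      simp [k01, k02, k03, k10, k12, k13, k20, k21, k23, k30, k31, k32]
    · linear_combination k00
    · linear_combination k00 - hy
    · linear_combination k00 - hy - k33
  · intro h
    rw [h, map_smul]
    congr 1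
    ext i j
    rw [sigma, rho_apply]
    fin_cases i <;> fin_cases j <;> simp [corr_self, Matrix.one_apply] <;> ring

theorem finrank_eigenspace_sigma {θ : Real.Angle} (hn : θ ≠ north) (hs : θ ≠ south) :
    Module.finrank ℂ (Module.End.eigenspace (sigma θ) 1) = 1 := by
  refine finrank_eq_of_forall_mem_iff_diagonal _ (fun _ ↦ 0) (by decide) fun A ↦ ?_
  rw [Module.End.mem_eigenspace_iff, one_smul, sigma_eq_self_iff hn hs]
  have (t : ℂ) : Matrix.diagonal (fun _ : Fin 4 ↦ t) = t • 1 := by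
    rw [Matrix.smul_one_eq_diagonal]
  constructor
  · exact fun h ↦ ⟨fun _ ↦ A 0 0, (this _).trans h.symm⟩
  · rintro ⟨v, rfl⟩
    exact (this (v 0)).trans (by simp)

theorem sigma_north_apply (A : Matrix (Fin 4) (Fin 4) ℂ) : sigma north A =
    !![A 0 0, 0, A 0 1, 0; 0, A 2 2, 0, A 2 3; A 1 0, 0, A 1 1, 0; 0, A 3 2, 0, A 3 3] := by
  ext i j
  rw [sigma, rho_apply]
  fin_cases i <;> fin_cases j <;> simp [corr_self, north_cos, north_sin]

theorem sigma_south_apply (A : Matrix (Fin 4) (Fin 4) ℂ) : sigma south A =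
    !![A 1 1, 0, A 1 2, 0; 0, A 1 1, 0, A 1 2; A 2 1, 0, A 2 2, 0; 0, A 2 1, 0, A 2 2] := by
  ext i j
  rw [sigma, rho_apply]
  fin_cases i <;> fin_cases j <;> simp [corr_self, south_cos, south_sin]

theorem finrank_eigenspace_sigma_north :
    Module.finrank ℂ (Module.End.eigenspace (sigma north) 1) = 3 := by
  refine finrank_eq_of_forall_mem_iff_diagonal _ ![0, 1, 1, 2] (by decide) fun A ↦ ?_
  rw [Module.End.mem_eigenspace_iff, one_smul, sigma_north_apply]
  constructor
  · intro h
    have h (r c) := congrFun (congrFun h r) c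
    simp [Fin.forall_fin_succ] at h
    refine ⟨![A 0 0, A 1 1, A 3 3], ?_⟩
    ext i j
    fin_cases i <;> fin_cases j <;> simp <;> grind
  · rintro ⟨v, rfl⟩
    ext i j
    fin_cases i <;> fin_cases j <;> simp

theorem finrank_eigenspace_sigma_south :
    Module.finrank ℂ (Module.End.eigenspace (sigma south) 1) = 2 := by
  refine finrank_eq_of_forall_mem_iff_diagonal _ ![0, 0, 1, 1] (by decide) fun A ↦ ?_
  rw [Module.End.mem_eigenspace_iff, one_smul, sigma_south_apply]
  constructor
  · intro h
    have h (r c) := congrFun (congrFun h r) c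
    simp [Fin.forall_fin_succ] at h
    refine ⟨![A 0 0, A 3 3], ?_⟩
    ext i j
    fin_cases i <;> fin_cases j <;> simp <;> grind
  · rintro ⟨v, rfl⟩
    ext i j
    fin_cases i <;> fin_cases j <;> simp

theorem finrank_eigenspace_sigma_north_neg_one :
    Module.finrank ℂ (Module.End.eigenspace (sigma north) (-1)) = 1 := by
  let B : Matrix (Fin 4) (Fin 4) ℂ := Matrix.diagonal ![0, 1, -1, 0]
  have hB : B ≠ 0 := fun h ↦ by simpa [B] using congrFun (congrFun h 1) 1
  suffices hE : Module.End.eigenspace (sigma north) (-1) = ℂ ∙ B by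
    rw [hE, finrank_span_singleton hB]
  ext A
  rw [Module.End.mem_eigenspace_iff, sigma_north_apply, Submodule.mem_span_singleton]
  constructor
  · intro h
    have h (r c) := congrFun (congrFun h r) c
    simp [Fin.forall_fin_succ] at h
    refine ⟨A 1 1, ?_⟩
    ext i j
    fin_cases i <;> fin_cases j <;> simp [B] <;> grind
  · rintro ⟨v, rfl⟩
    ext i j
    fin_cases i <;> fin_cases j <;> simp [B]

/-! ### The fixed points of `ρ` -/

theorem edge_det_ne_zero {c s c' s' : ℝ} (h : c ^ 2 + s ^ 2 = 1) (h' : c' ^ 2 + s' ^ 2 = 1)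
    (hne : ¬(s = -1 ∧ s' = 1)) :
    3 + c' - s' + c * (c' * (1 + c')) + s * (1 + s' * (1 + c')) ≠ 0 := by
  intro h0
  have hs' : s' ≤ 1 := by nlinarith
  have hc' : -1 ≤ c' := by nlinarith
  have h1 : (3 + c' - s') ^ 2 ≤ (c' * (1 + c')) ^ 2 + (1 + s' * (1 + c')) ^ 2 := by
    have : 3 + c' - s' = -(c * (c' * (1 + c')) + s * (1 + s' * (1 + c'))) := by linarith
    rw [this]
    have h2 := sq_nonneg (s * (c' * (1 + c')) - c * (1 + s' * (1 + c')))
    have h3 : (c ^ 2 + s ^ 2) * ((c' * (1 + c')) ^ 2 + (1 + s' * (1 + c')) ^ 2) =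
      (c' * (1 + c')) ^ 2 + (1 + s' * (1 + c')) ^ 2 := by rw [h, one_mul]
    linarith
  have h4 : (3 + c' - s') ^ 2 - ((c' * (1 + c')) ^ 2 + (1 + s' * (1 + c')) ^ 2) =
      (1 - s') * ((3 - s') + 4 * (1 + c')) := by
    linear_combination -(1 + c') ^ 2 * h'
  have h5 : 0 < (3 - s') + 4 * (1 + c') := by linarith
  have h6 : s' = 1 := by
    by_contra hs
    have : 0 < 1 - s' := by
      rcases lt_or_eq_of_le hs' with h | h
      · linarith
      · exact absurd h hs
    have := mul_pos this h5
    linarith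
  have h7 : c' = 0 := pow_eq_zero_iff two_ne_zero |>.1 (by rw [h6] at h'; linarith)
  rw [h6, h7] at h0
  exact hne ⟨by linarith, h6⟩

theorem edge_eq_zero {c s c' s' : ℝ} (h : c ^ 2 + s ^ 2 = 1) (h' : c' ^ 2 + s' ^ 2 = 1)
    (hne : ¬(s = -1 ∧ s' = 1)) {x y : ℂ}
    (hx : 4 * x = ((s * c' - c * s') - c - c') * x + (-(s * c' - c * s') + c - c') * y)
    (hy : 4 * y = (1 + (c * c' + s * s') + s + s') * x + (1 - (c * c' + s * s') - s + s') * y) :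
    x = 0 ∧ y = 0 := by
  have hd : (4 * (3 + c' - s' + c * (c' * (1 + c')) + s * (1 + s' * (1 + c'))) : ℂ) ≠ 0 :=
    mul_ne_zero (by norm_num) (mod_cast edge_det_ne_zero h h' hne)
  have h' : (c' ^ 2 + s' ^ 2 : ℂ) = 1 := mod_cast h'
  constructor
  · refine (mul_eq_zero_iff_left hd).1 ?_
    linear_combination (4 - (1 - (c * c' + s * s') - s + s') : ℂ) * hx +
      (-(s * c' - c * s') + c - c' : ℂ) * hy + 2 * c * x * h'
  · refine (mul_eq_zero_iff_left hd).1 ?_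
    linear_combination (4 - ((s * c' - c * s') - c - c') : ℂ) * hy +
      (1 + (c * c' + s * s') + s + s' : ℂ) * hx + 2 * c * y * h'

set_option maxHeartbeats 600000 in
theorem eq_zero_of_rho_eq_self {θ φ : Real.Angle} (hne : θ ≠ φ)
    (hex : ({θ, φ} : Set Real.Angle) ≠ {north, south}) {A : Matrix (Fin 4) (Fin 4) ℂ}
    (h : rho θ φ A = A) : A = 0 := by
  have h (r c) : A r c = _ := (congrFun (congrFun h r) c).symm.trans (rho_apply θ φ A r c)
  have e00 := h 0 0
  have e01 := h 0 1
  have e02 := h 0 2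
  have e03 := h 0 3
  have e10 := h 1 0
  have e11 := h 1 1
  have e12 := h 1 2
  have e13 := h 1 3
  have e20 := h 2 0
  have e21 := h 2 1
  have e22 := h 2 2
  have e23 := h 2 3
  have e30 := h 3 0
  have e31 := h 3 1
  have e32 := h 3 2
  have e33 := h 3 3
  simp [corr_eq] at e00 e01 e02 e03 e10 e11 e12 e13 e20 e21 e22 e23 e30 e31 e32 e33
  have hns : ¬(θ.sin = -1 ∧ φ.sin = 1) := by
    rintro ⟨h1, h2⟩
    exact hex (by rw [eq_south_of_sin h1, eq_north_of_sin h2, Set.pair_comm])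
  have hsn : ¬(φ.sin = -1 ∧ θ.sin = 1) := by
    rintro ⟨h1, h2⟩
    exact hex (by rw [eq_south_of_sin h1, eq_north_of_sin h2])
  have hθ := Real.Angle.cos_sq_add_sin_sq θ
  have hφ := Real.Angle.cos_sq_add_sin_sq φ
  have hC : θ.cos * φ.cos + θ.sin * φ.sin ≠ 1 := by
    intro hC
    have : (θ.cos - φ.cos) ^ 2 + (θ.sin - φ.sin) ^ 2 = 0 := by linarith
    exact hne (eq_of_cos_eq_of_sin_eq (by nlinarith) (by nlinarith))
  have hS : 2 + θ.sin + φ.sin ≠ 0 := by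
    intro hS
    have h1 : θ.sin = -1 := by nlinarith
    have h2 : φ.sin = -1 := by linarith
    exact hne ((eq_south_of_sin h1).trans (eq_south_of_sin h2).symm)
  generalize θ.cos = c, θ.sin = s, φ.cos = c', φ.sin = s' at *
  have hC' : (1 - (c * c' + s * s') : ℂ) ≠ 0 := fun h0 ↦ hC (by
    have : 1 - (c * c' + s * s') = 0 := mod_cast h0
    linarith)
  have hS' : (2 + s + s' : ℂ) ≠ 0 := mod_cast hS
  have hxz : A 1 1 + A 2 2 - (A 1 2 + A 2 1) = 0 := (mul_eq_zero_iff_left hC').1 (by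
    linear_combination 2 * e11 + 2 * e22)
  have hw : A 1 2 - A 2 1 = 0 := by
    linear_combination e12 - e21 - (s * c' - c * s') / 2 * hxz
  have hy : A 1 1 - A 2 2 = 0 := (mul_eq_zero_iff_left hS').1 (by
    linear_combination 2 * e11 - 2 * e22 + (s - s') * hw)
  have hz : A 1 2 + A 2 1 = 0 := by
    linear_combination e12 + e21 - (c + c') / 2 * hy + (c - c') / 2 * hw
  have k11 : A 1 1 = 0 := by linear_combination hxz / 2 + hz / 2 + hy / 2
  have k22 : A 2 2 = 0 := by linear_combination hxz / 2 + hz / 2 - hy / 2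
  have k12 : A 1 2 = 0 := by linear_combination hz / 2 + hw / 2
  have k21 : A 2 1 = 0 := by linear_combination hz / 2 - hw / 2
  simp only [k11, k22, k12, k21, mul_zero, add_zero, zero_add] at e00 e01 e02 e03 e10 e13 e20 e23 e30 e31 e32 e33
  obtain ⟨k01, k02⟩ := edge_eq_zero hθ hφ hns (x := A 0 1) (y := A 0 2)
    (by linear_combination 4 * e01) (by linear_combination 4 * e02)
  obtain ⟨k10, k20⟩ := edge_eq_zero hφ hθ hsn (x := A 1 0) (y := A 2 0)
    (by linear_combination 4 * e10) (by linear_combination 4 * e20)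
  obtain ⟨k32, k31⟩ := edge_eq_zero (c := -c) (c' := -c') (by rwa [neg_sq]) (by rwa [neg_sq]) hns
    (x := A 3 2) (y := A 3 1) (by push_cast; linear_combination 4 * e32)
    (by push_cast; linear_combination 4 * e31)
  obtain ⟨k23, k13⟩ := edge_eq_zero (c := -c') (c' := -c) (by rwa [neg_sq]) (by rwa [neg_sq]) hsn
    (x := A 2 3) (y := A 1 3) (by push_cast; linear_combination 4 * e23)
    (by push_cast; linear_combination 4 * e13)
  simp only [k01, k02, k10, k20, k32, k31, k23, k13, mul_zero, add_zero, zero_add] at e00 e03 e30 e33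
  have corner {x : ℂ} {t : ℝ} (ht : t ≠ 4) (hx : x = t / 4 * x) : x = 0 := by
    have ht' : (4 - t : ℂ) ≠ 0 := fun h0 ↦ ht (by
      have : 4 - t = 0 := mod_cast h0
      linarith)
    exact (mul_eq_zero_iff_left ht').1 (by linear_combination 4 * hx)
  have b1 : s ≤ 1 := by nlinarith
  have b2 : s' ≤ 1 := by nlinarith
  have b3 : c * c' + s * s' < 1 := lt_of_le_of_ne (by
    linarith [sq_nonneg (c - c'), sq_nonneg (s - s')]) hC
  have b4 : s * c' - c * s' ≤ 1 := by linarith [sq_nonneg (s - c'), sq_nonneg (c + s')]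
  have b5 : -1 ≤ s * c' - c * s' := by linarith [sq_nonneg (s + c'), sq_nonneg (c - s')]
  have b6 : c ≤ 1 := by nlinarith
  have b7 : c' ≤ 1 := by nlinarith
  have b8 : -1 ≤ c := by nlinarith
  have b9 : -1 ≤ c' := by nlinarith
  have k00 : A 0 0 = 0 := corner (t := 1 + (c * c' + s * s') + s + s') (by linarith)
    (by push_cast; linear_combination e00)
  have k33 : A 3 3 = 0 := corner (t := 1 + (c * c' + s * s') + s + s') (by linarith)
    (by push_cast; linear_combination e33)
  have k03 : A 0 3 = 0 := corner (t := -(s * c' - c * s') + c - c') (by linarith)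
    (by push_cast; linear_combination e03)
  have k30 : A 3 0 = 0 := corner (t := (s * c' - c * s') - c + c') (by linarith)
    (by push_cast; linear_combination e30)
  ext i j
  fin_cases i <;> fin_cases j <;>
    simp [k00, k01, k02, k03, k10, k11, k12, k13, k20, k21, k22, k23, k30, k31, k32, k33]

theorem rho_north_south_apply (A : Matrix (Fin 4) (Fin 4) ℂ) : rho north south A =
    !![A 1 0, 0, A 1 1, 0; 0, A 1 2, 0, A 1 3; A 2 0, 0, A 2 1, 0; 0, A 2 2, 0, A 2 3] := by
  ext i j
  rw [rho_apply]
  fin_cases i <;> fin_cases j <;>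
    simp [corr_eq, north_cos, north_sin, south_cos, south_sin] <;> norm_num

theorem rho_south_north_apply (A : Matrix (Fin 4) (Fin 4) ℂ) : rho south north A =
    !![A 0 1, 0, A 0 2, 0; 0, A 2 1, 0, A 2 2; A 1 1, 0, A 1 2, 0; 0, A 3 1, 0, A 3 2] := by
  ext i j
  rw [rho_apply]
  fin_cases i <;> fin_cases j <;>
    simp [corr_eq, north_cos, north_sin, south_cos, south_sin] <;> norm_num

theorem finrank_eq_two_of_forall_mem_iff_single
    (E : Submodule ℂ (Matrix (Fin 4) (Fin 4) ℂ)) {i j k l : Fin 4} (hne : ¬(k = i ∧ l = j))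
    (hE : ∀ A, A ∈ E ↔ ∃ v : Fin 2 → ℂ, Matrix.single i j (v 0) + Matrix.single k l (v 1) = A) :
    Module.finrank ℂ E = 2 := by
  let f : (Fin 2 → ℂ) →ₗ[ℂ] Matrix (Fin 4) (Fin 4) ℂ :=
    Matrix.singleLinearMap ℂ i j ∘ₗ LinearMap.proj (R := ℂ) (φ := fun _ : Fin 2 ↦ ℂ) 0 +
      Matrix.singleLinearMap ℂ k l ∘ₗ LinearMap.proj (R := ℂ) (φ := fun _ : Fin 2 ↦ ℂ) 1
  have hf (v) : f v = Matrix.single i j (v 0) + Matrix.single k l (v 1) := rfl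
  have hr : E = LinearMap.range f := by
    ext A
    rw [hE, LinearMap.mem_range]
    rfl
  rw [hr, LinearMap.finrank_range_of_inj, Module.finrank_fin_fun]
  intro v w h
  rw [hf, hf] at h
  ext a
  fin_cases a
  · simpa [Matrix.single_apply, hne] using congrFun (congrFun h i) j
  · have hne' : ¬(i = k ∧ j = l) := fun h ↦ hne ⟨h.1.symm, h.2.symm⟩
    simpa [Matrix.single_apply, hne'] using congrFun (congrFun h k) l

theorem finrank_eigenspace_rho_north_south :
    Module.finrank ℂ (Module.End.eigenspace (rho north south) 1) = 2 := by
  refine finrank_eq_two_of_forall_mem_iff_single _ (i := 1) (j := 3) (k := 2) (l := 0)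
    (by decide) fun A ↦ ?_
  rw [Module.End.mem_eigenspace_iff, one_smul, rho_north_south_apply]
  constructor
  · intro h
    have h (r c) := congrFun (congrFun h r) c
    simp [Fin.forall_fin_succ] at h
    refine ⟨![A 1 3, A 2 0], ?_⟩
    ext i j
    fin_cases i <;> fin_cases j <;> simp <;> grind
  · rintro ⟨v, rfl⟩
    ext i j
    fin_cases i <;> fin_cases j <;> simp

theorem finrank_eigenspace_rho_south_north :
    Module.finrank ℂ (Module.End.eigenspace (rho south north) 1) = 2 := by
  refine finrank_eq_two_of_forall_mem_iff_single _ (i := 0) (j := 2) (k := 3) (l := 1)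
    (by decide) fun A ↦ ?_
  rw [Module.End.mem_eigenspace_iff, one_smul, rho_south_north_apply]
  constructor
  · intro h
    have h (r c) := congrFun (congrFun h r) c
    simp [Fin.forall_fin_succ] at h
    refine ⟨![A 0 2, A 3 1], ?_⟩
    ext i j
    fin_cases i <;> fin_cases j <;> simp <;> grind
  · rintro ⟨v, rfl⟩
    ext i j
    fin_cases i <;> fin_cases j <;> simp

end

end GenusTwo

open CuntzRep MeasureTheory
open scoped InnerProductSpace Matrix

namespace GenusTwo

noncomputable section

/-! ### The action on the Fourier basis -/

theorem inner_e (m n : ℤ) : ⟪e m, e n⟫_ℂ = if m = n then 1 else 0 :=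
  orthonormal_iff_ite.1 (orthonormal_fourier (T := (1 : ℝ))) m n

theorem dense_span_e : Dense (Submodule.span ℂ (Set.range e) : Set L2T) := by
  rw [Submodule.dense_iff_topologicalClosure_eq_top]
  exact span_fourierLp_closure_eq_top (by norm_num)

theorem ext_e {F : Type*} [NormedAddCommGroup F] [NormedSpace ℂ F] {T T' : L2T →L[ℂ] F}
    (h : ∀ n, T (e n) = T' (e n)) : T = T' := by
  refine ContinuousLinearMap.ext_on dense_span_e ?_
  rintro _ ⟨n, rfl⟩
  exact h n

theorem ext_inner_e {x y : L2T} (h : ∀ n, ⟪e n, x⟫_ℂ = ⟪e n, y⟫_ℂ) : x = y := by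
  have h1 : innerSL ℂ x = innerSL ℂ y := ext_e fun n ↦ by
    rw [innerSL_apply_apply, innerSL_apply_apply, ← inner_conj_symm, h, inner_conj_symm]
  exact (innerSL_inj).1 h1

theorem ext_inner_e_e {T T' : L2T →L[ℂ] L2T} (h : ∀ m n, ⟪e m, T (e n)⟫_ℂ = ⟪e m, T' (e n)⟫_ℂ) :
    T = T' :=
  ext_e fun n ↦ ext_inner_e fun m ↦ h m n

theorem filterOp_e (m : C(UnitAddCircle, ℂ)) (n : ℤ) :
    filterOp m (e n) =
      ContinuousMap.toLp (E := ℂ) 2 AddCircle.haarAddCircle ℂ (m * fourier (2 * n)) := by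
  refine Lp.ext ?_
  have h1 := filterOp_ae m (e n)
  have h2 := ContinuousMap.coeFn_toLp (E := ℂ) (p := 2) (𝕜 := ℂ)
    (AddCircle.haarAddCircle (T := (1 : ℝ))) (m * fourier (2 * n))
  have h3 := measurePreserving_double.quasiMeasurePreserving.ae_eq_comp
    (coeFn_fourierLp (T := (1 : ℝ)) 2 n)
  filter_upwards [h1, h2, h3] with x hx1 hx2 hx3
  simp only [Function.comp_apply] at hx3
  rw [hx1, hx2, hx3, ContinuousMap.mul_apply, fourier_apply, fourier_apply, smul_smul, mul_comm n]

/-- The coefficients of the two filters. -/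
def coeff (θ : Real.Angle) : Fin 2 → Fin 4 → ℝ :=
  ![lowCoeff θ, highCoeff θ]

theorem rep_e (θ : Real.Angle) (i : Fin 2) (n : ℤ) : rep θ i (e n) =
    (coeff θ i 0 : ℂ) • e (2 * n) + (coeff θ i 1 : ℂ) • e (2 * n + 1) +
      (coeff θ i 2 : ℂ) • e (2 * n + 2) + (coeff θ i 3 : ℂ) • e (2 * n + 3) := by
  have hf (k : ℤ) : (fourier k * fourier (2 * n) : C(UnitAddCircle, ℂ)) = fourier (2 * n + k) := by
    ext x
    rw [ContinuousMap.mul_apply, add_comm, fourier_add]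
  have h (c : Fin 4 → ℝ) : filterOp (filterPoly c) (e n) =
      (c 0 : ℂ) • e (2 * n) + (c 1 : ℂ) • e (2 * n + 1) +
        (c 2 : ℂ) • e (2 * n + 2) + (c 3 : ℂ) • e (2 * n + 3) := by
    rw [filterOp_e, filterPoly, Finset.sum_mul]
    simp only [smul_mul_assoc, hf, Fin.sum_univ_four]
    simp [e, fourierLp]
  fin_cases i
  · exact h _
  · exact h _

theorem star_rep_e_even (θ : Real.Angle) (i : Fin 2) (n : ℤ) : star (rep θ i) (e (2 * n)) =
    (coeff θ i 0 : ℂ) • e n + (coeff θ i 2 : ℂ) • e (n - 1) := by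
  refine ext_inner_e fun m ↦ ?_
  rw [ContinuousLinearMap.star_eq_adjoint, ContinuousLinearMap.adjoint_inner_right, rep_e]
  simp only [inner_add_left, inner_add_right, inner_smul_left, inner_smul_right, inner_e,
    Complex.conj_ofReal]
  rw [if_neg (show ¬(2 * m + 1 = 2 * n) by omega), if_neg (show ¬(2 * m + 3 = 2 * n) by omega)]
  simp only [show (2 * m = 2 * n) = (m = n) from propext (by omega),
    show (2 * m + 2 = 2 * n) = (m = n - 1) from propext (by omega)]
  ring

theorem star_rep_e_odd (θ : Real.Angle) (i : Fin 2) (n : ℤ) : star (rep θ i) (e (2 * n + 1)) =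
    (coeff θ i 1 : ℂ) • e n + (coeff θ i 3 : ℂ) • e (n - 1) := by
  refine ext_inner_e fun m ↦ ?_
  rw [ContinuousLinearMap.star_eq_adjoint, ContinuousLinearMap.adjoint_inner_right, rep_e]
  simp only [inner_add_left, inner_add_right, inner_smul_left, inner_smul_right, inner_e,
    Complex.conj_ofReal]
  rw [if_neg (show ¬(2 * m = 2 * n + 1) by omega), if_neg (show ¬(2 * m + 2 = 2 * n + 1) by omega)]
  simp only [show (2 * m + 1 = 2 * n + 1) = (m = n) from propext (by omega),
    show (2 * m + 3 = 2 * n + 1) = (m = n - 1) from propext (by omega)]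
  ring

theorem exists_star_rep_e (θ : Real.Angle) (i : Fin 2) (n : ℤ) : ∃ a b : ℂ,
    star (rep θ i) (e n) = a • e (n / 2) + b • e (n / 2 - 1) := by
  obtain ⟨k, rfl | rfl⟩ := Int.even_or_odd' n
  · refine ⟨coeff θ i 0, coeff θ i 2, (star_rep_e_even θ i k).trans ?_⟩
    rw [show 2 * k / 2 = k by omega]
  · refine ⟨coeff θ i 1, coeff θ i 3, (star_rep_e_odd θ i k).trans ?_⟩
    rw [show (2 * k + 1) / 2 = k by omega]

theorem sum_coeff_mul_coeff (θ : Real.Angle) (j k : Fin 4) :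
    coeff θ 0 j * coeff θ 0 k + coeff θ 1 j * coeff θ 1 k = corr θ θ j k := rfl

theorem coeff_orthonormal (θ : Real.Angle) (i j : Fin 2) :
    coeff θ i 0 * coeff θ j 0 + coeff θ i 1 * coeff θ j 1 + coeff θ i 2 * coeff θ j 2 +
      coeff θ i 3 * coeff θ j 3 = if i = j then 1 else 0 := by
  have h := Real.Angle.cos_sq_add_sin_sq θ
  fin_cases i <;> fin_cases j <;>
    simp [coeff, highCoeff_eq, lowCoeff, div_two_sqrt_two_mul] <;> linarith

theorem coeff_shift_orthogonal (θ : Real.Angle) (i j : Fin 2) :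
    coeff θ i 0 * coeff θ j 2 + coeff θ i 1 * coeff θ j 3 = 0 := by
  have h := Real.Angle.cos_sq_add_sin_sq θ
  fin_cases i <;> fin_cases j <;>
    simp [coeff, highCoeff_eq, lowCoeff, div_two_sqrt_two_mul] <;> linarith

theorem isCuntzFamily_rep (θ : Real.Angle) : IsCuntzFamily (rep θ) := by
  constructor
  · intro i j
    refine ext_e fun n ↦ ?_
    have h1 : (coeff θ i 0 * coeff θ j 0 + coeff θ i 1 * coeff θ j 1 + coeff θ i 2 * coeff θ j 2 +
      coeff θ i 3 * coeff θ j 3 : ℂ) = if i = j then 1 else 0 := by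
        have := coeff_orthonormal θ i j
        split_ifs at this ⊢ <;> exact_mod_cast this
    have h2 : (coeff θ i 0 * coeff θ j 2 + coeff θ i 1 * coeff θ j 3 : ℂ) = 0 :=
      mod_cast coeff_shift_orthogonal θ i j
    have h3 : (coeff θ j 0 * coeff θ i 2 + coeff θ j 1 * coeff θ i 3 : ℂ) = 0 :=
      mod_cast coeff_shift_orthogonal θ j i
    have hn : (if i = j then (1 : L2T →L[ℂ] L2T) else 0) (e n) =
        (if i = j then (1 : ℂ) else 0) • e n := by split_ifs <;> simp
    rw [hn, ← h1, mul_apply_eq_comp, rep_e,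
      show 2 * n + 2 = 2 * (n + 1) by ring, show 2 * n + 3 = 2 * (n + 1) + 1 by ring]
    simp only [map_add, map_smul, star_rep_e_even, star_rep_e_odd, add_sub_cancel_right]
    linear_combination (norm := module) h2 • e (n + 1) + h3 • e (n - 1)
  · refine ext_e fun n ↦ ?_
    have hK (j k : Fin 4) : (coeff θ 0 j * coeff θ 0 k + coeff θ 1 j * coeff θ 1 k : ℂ) =
        (corr θ θ j k : ℂ) := by exact_mod_cast sum_coeff_mul_coeff θ j k
    rw [Fin.sum_univ_two, add_apply, mul_apply_eq_comp,
      mul_apply_eq_comp, one_apply_eq_self]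
    obtain ⟨k, rfl | rfl⟩ := Int.even_or_odd' n
    · have a0 := hK 0 0
      have a1 := hK 0 1
      have a2 := hK 0 2
      have a3 := hK 0 3
      have b0 := hK 2 0
      have b1 := hK 2 1
      have b2 := hK 2 2
      have b3 := hK 2 3
      simp [corr_self] at a0 a1 a2 a3 b0 b1 b2 b3
      simp only [star_rep_e_even, map_add, map_smul, rep_e]
      rw [show 2 * (k - 1) + 2 = 2 * k by ring, show 2 * (k - 1) + 3 = 2 * k + 1 by ring]
      linear_combination (norm := module) a0 • e (2 * k) + a1 • e (2 * k + 1) + a2 • e (2 * k + 2) +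
        a3 • e (2 * k + 3) + b0 • e (2 * (k - 1)) + b1 • e (2 * (k - 1) + 1) + b2 • e (2 * k) +
        b3 • e (2 * k + 1)
    · have a0 := hK 1 0
      have a1 := hK 1 1
      have a2 := hK 1 2
      have a3 := hK 1 3
      have b0 := hK 3 0
      have b1 := hK 3 1
      have b2 := hK 3 2
      have b3 := hK 3 3
      simp [corr_self] at a0 a1 a2 a3 b0 b1 b2 b3
      simp only [star_rep_e_odd, map_add, map_smul, rep_e]
      rw [show 2 * (k - 1) + 2 = 2 * k by ring, show 2 * (k - 1) + 3 = 2 * k + 1 by ring]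
      linear_combination (norm := module) a0 • e (2 * k) + a1 • e (2 * k + 1) + a2 • e (2 * k + 2) +
        a3 • e (2 * k + 3) + b0 • e (2 * (k - 1)) + b1 • e (2 * (k - 1) + 1) + b2 • e (2 * k) +
        b3 • e (2 * k + 1)

theorem star_rep_e_neg (θ : Real.Angle) (i : Fin 2) (c : Fin 4) :
    star (rep θ i) (e (-(c : ℤ))) = ∑ r : Fin 4, Vstar θ i r c • e (-(r : ℤ)) := by
  have hV : Vstar θ i = slantToeplitz (coeff θ i) := by
    fin_cases i <;> rfl
  rw [hV, Fin.sum_univ_four]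
  fin_cases c
  · have := star_rep_e_even θ i 0
    simp [slantToeplitz] at this ⊢
    exact this
  · have := star_rep_e_odd θ i (-1)
    simp [slantToeplitz] at this ⊢
    exact this
  · have := star_rep_e_even θ i (-1)
    simp [slantToeplitz] at this ⊢
    exact this
  · have := star_rep_e_odd θ i (-2)
    simp [slantToeplitz] at this ⊢
    exact this

/-! ### Compression to `𝒦` -/

/-- The matrix of the compression of a bounded operator to `span {e_0, e_{-1}, e_{-2}, e_{-3}}`. -/
def compression : (L2T →L[ℂ] L2T) →ₗ[ℂ] Matrix (Fin 4) (Fin 4) ℂ where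
  toFun U := Matrix.of fun r c : Fin 4 ↦ ⟪e (-(r : ℤ)), U (e (-(c : ℤ)))⟫_ℂ
  map_add' U V := by
    ext r c
    exact inner_add_right (𝕜 := ℂ) (E := L2T) _ _ _
  map_smul' t U := by
    ext r c
    exact inner_smul_right (𝕜 := ℂ) (E := L2T) _ _ _

theorem compression_apply (U : L2T →L[ℂ] L2T) (r c : Fin 4) :
    compression U r c = ⟪e (-(r : ℤ)), U (e (-(c : ℤ)))⟫_ℂ := rfl

theorem compression_one : compression 1 = 1 := by
  ext r c
  rw [compression_apply, one_apply_eq_self, inner_e, Matrix.one_apply]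
  congr 1
  rw [neg_inj, Nat.cast_inj, Fin.val_inj]

theorem norm_compression_apply_le (U : L2T →L[ℂ] L2T) (r c : Fin 4) :
    ‖compression U r c‖ ≤ ‖U‖ := by
  have hn (n : ℤ) : ‖e n‖ = 1 := (orthonormal_fourier (T := (1 : ℝ))).1 n
  refine (norm_inner_le_norm (𝕜 := ℂ) (E := L2T) _ _).trans ?_
  rw [hn, one_mul]
  exact (U.le_opNorm _).trans_eq (by rw [hn, mul_one])

theorem compression_sum_conj (θ φ : Real.Angle) (U : L2T →L[ℂ] L2T) :
    compression (∑ i, rep φ i * U * star (rep θ i)) = rho θ φ (compression U) := by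
  rw [map_sum]
  change _ = ∑ i : Fin 2, (Vstar φ i)ᴴ * compression U * Vstar θ i
  refine Finset.sum_congr rfl fun i _ ↦ ?_
  ext r c
  rw [compression_apply, mul_apply_eq_comp, mul_apply_eq_comp,
    ← ContinuousLinearMap.adjoint_inner_left, ← ContinuousLinearMap.star_eq_adjoint,
    star_rep_e_neg, star_rep_e_neg, map_sum, inner_sum, Matrix.mul_apply]
  refine Finset.sum_congr rfl fun t _ ↦ ?_
  rw [map_smul, inner_smul_right, sum_inner, Matrix.mul_apply, mul_comm]
  congr 1
  refine Finset.sum_congr rfl fun s _ ↦ ?_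
  rw [inner_smul_left]
  rfl

theorem eq_zero_of_compression_eq_zero {θ φ : Real.Angle} {B : ℕ → L2T →L[ℂ] L2T}
    (hB : ∀ k, B k = ∑ i, rep φ i * B (k + 1) * star (rep θ i))
    (h0 : ∀ k, compression (B k) = 0) (k : ℕ) : B k = 0 := by
  have key (N : ℕ) : ∀ (m n : ℤ), -3 - N ≤ m → m ≤ N → -3 - N ≤ n → n ≤ N →
      ∀ k, ⟪e m, B k (e n)⟫_ℂ = 0 := by
    induction N with
    | zero =>
      intro m n hm hm' hn hn' k
      have := congrFun (congrFun (h0 k) ⟨(-m).toNat, by omega⟩) ⟨(-n).toNat, by omega⟩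
      rw [compression_apply] at this
      simp only [Matrix.zero_apply] at this
      rwa [Int.toNat_of_nonneg (by omega), Int.toNat_of_nonneg (by omega), neg_neg, neg_neg] at this
    | succ N ih =>
      intro m n hm hm' hn hn' k
      push_cast at hm hm' hn hn'
      rw [hB, sum_apply, inner_sum]
      refine Finset.sum_eq_zero fun i _ ↦ ?_
      rw [mul_apply_eq_comp, mul_apply_eq_comp,
        ← ContinuousLinearMap.adjoint_inner_left, ← ContinuousLinearMap.star_eq_adjoint]
      obtain ⟨a, b, hab⟩ := exists_star_rep_e φ i m
      obtain ⟨c, d, hcd⟩ := exists_star_rep_e θ i n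
      rw [hab, hcd, map_add, map_smul, map_smul]
      simp only [inner_add_left, inner_add_right, inner_smul_left, inner_smul_right]
      rw [ih (m / 2) (n / 2), ih (m / 2 - 1) (n / 2), ih (m / 2) (n / 2 - 1),
        ih (m / 2 - 1) (n / 2 - 1)]
      · simp
      all_goals omega
  refine ext_inner_e_e fun m n ↦ ?_
  rw [key (m.natAbs + n.natAbs) m n (by omega) (by omega) (by omega) (by omega) k]
  simp

/-! ### Intertwiners -/

variable {θ φ : Real.Angle}

theorem mem_intertwiners {U : L2T →L[ℂ] L2T} :
    U ∈ intertwiners (rep θ) (rep φ) ↔ ∀ i, U * rep θ i = rep φ i * U :=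
  Iff.rfl

theorem mul_star_rep_of_mem_intertwiners {U : L2T →L[ℂ] L2T}
    (hU : U ∈ intertwiners (rep θ) (rep φ)) (i : Fin 2) :
    U * star (rep θ i) = star (rep φ i) * U := by
  rw [mem_intertwiners] at hU
  calc U * star (rep θ i)
      = ∑ j, star (rep φ i) * rep φ j * U * star (rep θ j) := by
        simp [(isCuntzFamily_rep φ).1]
    _ = star (rep φ i) * U * ∑ j, rep θ j * star (rep θ j) := by
        rw [Finset.mul_sum]
        refine Finset.sum_congr rfl fun j _ ↦ ?_
        rw [mul_assoc (star _) (rep φ j), ← hU j]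
        simp only [mul_assoc]
    _ = star (rep φ i) * U := by rw [(isCuntzFamily_rep θ).2, mul_one]

theorem star_mem_intertwiners {U : L2T →L[ℂ] L2T}
    (hU : U ∈ intertwiners (rep θ) (rep φ)) : star U ∈ intertwiners (rep φ) (rep θ) := by
  rw [mem_intertwiners]
  intro i
  have := congrArg star (mul_star_rep_of_mem_intertwiners hU i)
  simpa using this.symm

theorem eq_sum_conj_of_mem_intertwiners {U : L2T →L[ℂ] L2T}
    (hU : U ∈ intertwiners (rep θ) (rep φ)) : U = ∑ i, rep φ i * U * star (rep θ i) := by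
  rw [mem_intertwiners] at hU
  calc U = U * ∑ i, rep θ i * star (rep θ i) := by rw [(isCuntzFamily_rep θ).2, mul_one]
    _ = _ := by
      rw [Finset.mul_sum]
      exact Finset.sum_congr rfl fun i _ ↦ by rw [← hU i, mul_assoc]

/-- Compression maps intertwiners to fixed points of `ρ`. -/
def intertwinersToFixed (θ φ : Real.Angle) :
    intertwiners (rep θ) (rep φ) →ₗ[ℂ] Module.End.eigenspace (rho θ φ) 1 :=
  compression.restrict fun U hU ↦ by
    rw [Module.End.mem_eigenspace_iff, one_smul, ← compression_sum_conj,
      ← eq_sum_conj_of_mem_intertwiners hU]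

theorem intertwinersToFixed_injective (θ φ : Real.Angle) :
    Function.Injective (intertwinersToFixed θ φ) := by
  rw [injective_iff_map_eq_zero]
  intro U hU
  have h0 : compression (U : L2T →L[ℂ] L2T) = 0 := congrArg Subtype.val hU
  exact Subtype.ext (eq_zero_of_compression_eq_zero (B := fun _ ↦ U)
    (fun _ ↦ eq_sum_conj_of_mem_intertwiners U.2) (fun _ ↦ h0) 0)

instance (θ φ : Real.Angle) : FiniteDimensional ℂ (intertwiners (rep θ) (rep φ)) :=
  FiniteDimensional.of_injective _ (intertwinersToFixed_injective θ φ)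

theorem finrank_intertwiners_le (θ φ : Real.Angle) :
    Module.finrank ℂ (intertwiners (rep θ) (rep φ)) ≤
      Module.finrank ℂ (Module.End.eigenspace (rho θ φ) 1) :=
  LinearMap.finrank_le_finrank_of_injective (intertwinersToFixed_injective θ φ)

theorem areDisjoint_rep (hne : θ ≠ φ) (hex : ({θ, φ} : Set Real.Angle) ≠ {north, south}) :
    AreDisjoint (rep θ) (rep φ) := by
  rw [AreDisjoint, Submodule.eq_bot_iff]
  intro U hU
  have h : intertwinersToFixed θ φ ⟨U, hU⟩ = intertwinersToFixed θ φ 0 := by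
    refine Subtype.ext ?_
    have := (intertwinersToFixed θ φ ⟨U, hU⟩).2
    rw [Module.End.mem_eigenspace_iff, one_smul] at this
    rw [eq_zero_of_rho_eq_self hne hex this, map_zero]
    rfl
  exact congrArg Subtype.val (intertwinersToFixed_injective θ φ h)

end

end GenusTwo

namespace CuntzRep

variable {N : ℕ} {H : Type*} [NormedAddCommGroup H] [InnerProductSpace ℂ H]

/-! ### The commutants of `π(𝒪_N)` and of `π(UHF_N)` -/

theorem mem_commutant {𝒜 : Set (H →L[ℂ] H)} {U : H →L[ℂ] H} :
    U ∈ commutant 𝒜 ↔ ∀ T ∈ 𝒜, T * U = U * T :=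
  Iff.rfl

theorem isClosed_setOf_commute (U : H →L[ℂ] H) : IsClosed {T : H →L[ℂ] H | T * U = U * T} :=
  isClosed_eq (continuous_id.mul continuous_const) (continuous_const.mul continuous_id)

variable [CompleteSpace H]

theorem mem_cuntzImage (S : Fin N → H →L[ℂ] H) (i : Fin N) : S i ∈ cuntzImage S :=
  subset_closure (StarAlgebra.subset_adjoin ℂ _ ⟨i, rfl⟩)

theorem star_mem_cuntzImage {S : Fin N → H →L[ℂ] H} {T : H →L[ℂ] H} (hT : T ∈ cuntzImage S) :
    star T ∈ cuntzImage S :=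
  star_mem (S := StarSubalgebra ℂ (H →L[ℂ] H)) hT

theorem mem_commutant_cuntzImage {S : Fin N → H →L[ℂ] H} {U : H →L[ℂ] H}
    (h : ∀ i, S i * U = U * S i) (h' : ∀ i, star (S i) * U = U * star (S i)) :
    U ∈ commutant (cuntzImage S) := by
  rw [mem_commutant]
  refine fun T hT ↦ closure_minimal ?_ (isClosed_setOf_commute U) hT
  intro T hT
  suffices T * U = U * T ∧ star T * U = U * star T from this.1
  simp only [SetLike.mem_coe] at hT
  induction hT using StarAlgebra.adjoin_induction with
  | mem T h =>
    obtain ⟨i, rfl⟩ := h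
    exact ⟨h i, h' i⟩
  | algebraMap r =>
    rw [← algebraMap_star_comm]
    exact ⟨Algebra.commutes _ _, Algebra.commutes _ _⟩
  | add x y _ _ hx hy =>
    simp only [star_add, add_mul, mul_add, hx.1, hx.2, hy.1, hy.2, and_self]
  | mul x y _ _ hx hy =>
    refine ⟨?_, ?_⟩
    · rw [mul_assoc, hy.1, ← mul_assoc, hx.1, mul_assoc]
    · rw [star_mul, mul_assoc, hx.2, ← mul_assoc, hy.2, mul_assoc]
  | star x _ hx => exact ⟨hx.2, by rw [star_star]; exact hx.1⟩

theorem monomial_mul_star_mem_uhfImage (S : Fin N → H →L[ℂ] H) {I J : List (Fin N)}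
    (h : I.length = J.length) : monomial S I * star (monomial S J) ∈ uhfImage S :=
  subset_closure (Submodule.subset_span ⟨I, J, h, rfl⟩)

theorem star_mem_uhfImage {S : Fin N → H →L[ℂ] H} {T : H →L[ℂ] H} (hT : T ∈ uhfImage S) :
    star T ∈ uhfImage S := by
  refine map_mem_closure continuous_star hT ?_
  intro T hT
  simp only [SetLike.mem_coe] at hT ⊢
  induction hT using Submodule.span_induction with
  | mem T h =>
    obtain ⟨I, J, h, rfl⟩ := h
    exact Submodule.subset_span ⟨J, I, h.symm, by rw [star_mul, star_star]⟩
  | zero => simp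
  | add x y _ _ hx hy => rw [star_add]; exact add_mem hx hy
  | smul t x _ hx => rw [star_smul]; exact Submodule.smul_mem _ _ hx

/-- The orthogonal projection onto a closed subspace. -/
theorem exists_projection (M : Submodule ℂ H) (hM : IsClosed (M : Set H)) :
    ∃ P : H →L[ℂ] H, (∀ x, P x ∈ M) ∧ (∀ x ∈ M, P x = x) ∧ IsSelfAdjoint P := by
  have : CompleteSpace M := hM.completeSpace_coe
  exact ⟨M.starProjection, fun x ↦ M.starProjection_apply_mem x,
    fun x hx ↦ Submodule.starProjection_eq_self_iff.2 hx, isSelfAdjoint_starProjection M⟩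

theorem projection_mem_commutant {𝒜 : Set (H →L[ℂ] H)} (hstar : ∀ T ∈ 𝒜, star T ∈ 𝒜)
    {M : Submodule ℂ H} (hM : IsInvariant 𝒜 M) {P : H →L[ℂ] H} (hP : ∀ x, P x ∈ M)
    (hP' : ∀ x ∈ M, P x = x) (hsa : IsSelfAdjoint P) : P ∈ commutant 𝒜 := by
  have h (T) (hT : T ∈ 𝒜) : P * T * P = T * P := by
    ext x
    exact hP' _ (hM T hT _ (hP x))
  rw [mem_commutant]
  intro T hT
  have h2 := congrArg star (h (star T) (hstar T hT))
  simp only [star_mul, star_star, hsa.star_eq] at h2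
  rw [← h T hT, mul_assoc]
  exact h2

theorem actsIrreducibly_of_commutant [Nontrivial H] {𝒜 : Set (H →L[ℂ] H)}
    (hstar : ∀ T ∈ 𝒜, star T ∈ 𝒜) (h : ∀ U ∈ commutant 𝒜, ∃ t : ℂ, U = t • 1) :
    ActsIrreducibly 𝒜 := by
  refine ⟨bot_ne_top.symm, isClosed_univ, fun _ _ _ _ ↦ Submodule.mem_top, fun L _ hL hinv ↦ ?_⟩
  obtain ⟨P, hP, hP', hsa⟩ := exists_projection L hL
  obtain ⟨t, rfl⟩ := h P (projection_mem_commutant hstar hinv hP hP' hsa)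
  by_cases ht : t = 0
  · left
    rw [Submodule.eq_bot_iff]
    intro x hx
    rw [← hP' x hx, ht]
    simp
  · right
    rw [Submodule.eq_top_iff']
    intro x
    have := L.smul_mem t⁻¹ (hP x)
    simpa [smul_smul, inv_mul_cancel₀ ht] using this

end CuntzRep

theorem Submodule.finrank_eq_and_exists_sum_smul {V : Type*} [AddCommGroup V] [Module ℂ V]
    (W : Submodule ℂ V) [FiniteDimensional ℂ W] {k : ℕ} (hk : Module.finrank ℂ W ≤ k)
    {v : Fin k → V} (hv : LinearIndependent ℂ v) (hvW : ∀ j, v j ∈ W) :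
    Module.finrank ℂ W = k ∧ ∀ u ∈ W, ∃ t : Fin k → ℂ, u = ∑ j, t j • v j := by
  have hspan : span ℂ (Set.range v) ≤ W := by
    rw [span_le]
    rintro _ ⟨j, rfl⟩
    exact hvW j
  have hcard : Module.finrank ℂ (span ℂ (Set.range v)) = k := by
    rw [finrank_span_eq_card hv, Fintype.card_fin]
  have heq : span ℂ (Set.range v) = W :=
    Submodule.eq_of_le_of_finrank_le hspan (hk.trans hcard.ge)
  refine ⟨heq ▸ hcard, fun u hu ↦ ?_⟩
  rw [← heq, mem_span_range_iff_exists_fun] at hu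
  obtain ⟨t, ht⟩ := hu
  exact ⟨t, ht.symm⟩

open Polynomial in
theorem LinearMap.eq_zero_of_bounded_backward_orbit {V : Type*} [NormedAddCommGroup V]
    [NormedSpace ℂ V] (f : V →ₗ[ℂ] V) (s : Multiset ℂ) (hs : ∀ t ∈ s, ‖t‖ < 1) (B : ℕ → V)
    (hbdd : ∃ M, ∀ k, ‖B k‖ ≤ M) (hB : ∀ k, f (B (k + 1)) = B k)
    (h0 : ∀ k, aeval f (s.map (X - C ·)).prod (B k) = 0) (k : ℕ) : B k = 0 := by
  induction s using Multiset.induction_on generalizing B k with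
  | empty => simpa using h0 k
  | cons t s ih =>
    obtain ⟨M, hM⟩ := hbdd
    have ht : ‖t‖ < 1 := hs t (Multiset.mem_cons_self t s)
    have hD (k : ℕ) : f (B k) - t • B k = 0 := by
      refine ih (fun u hu ↦ hs u (Multiset.mem_cons_of_mem hu)) (fun k ↦ f (B k) - t • B k)
        ⟨‖f (B 0) - t • B 0‖ + (M + ‖t‖ * M), fun k ↦ ?_⟩ (fun k ↦ ?_) (fun k ↦ ?_) k
      · have hM0 : 0 ≤ M := (norm_nonneg _).trans (hM 0)
        cases k with
        | zero => exact le_add_of_nonneg_right (by positivity)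
        | succ k =>
          refine le_add_of_nonneg_of_le (norm_nonneg _) ?_
          rw [hB]
          refine (norm_sub_le _ _).trans (add_le_add (hM k) ?_)
          rw [norm_smul]
          exact mul_le_mul_of_nonneg_left (hM _) (norm_nonneg _)
      · simp only [map_sub, map_smul, hB]
      · have := h0 k
        rw [Multiset.map_cons, Multiset.prod_cons, mul_comm, map_mul, Module.End.mul_apply] at this
        simpa [Module.algebraMap_end_apply] using this
    have hstep (k : ℕ) : B k = t • B (k + 1) := by
      have := hD (k + 1)
      rw [hB, sub_eq_zero] at this
      exact this
    have hpow (j : ℕ) : B k = t ^ j • B (k + j) := by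
      induction j with
      | zero => simp
      | succ j ihj => rw [ihj, hstep, smul_smul, pow_succ, add_assoc]
    have hlim : Filter.Tendsto (fun j : ℕ ↦ ‖t‖ ^ j * M) Filter.atTop (nhds (0 * M)) :=
      (tendsto_pow_atTop_nhds_zero_of_lt_one (norm_nonneg t) ht).mul_const M
    rw [zero_mul] at hlim
    refine norm_le_zero_iff.1 (ge_of_tendsto' hlim fun j ↦ ?_)
    rw [hpow j, norm_smul, norm_pow]
    exact mul_le_mul_of_nonneg_left (hM _) (by positivity)

namespace CuntzRep

variable {N : ℕ} {H : Type*} [NormedAddCommGroup H] [InnerProductSpace ℂ H]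

theorem linearIndependent_of_orthogonal_idempotents {k : ℕ} {P : Fin k → H →L[ℂ] H}
    (hne : ∀ j, P j ≠ 0) (hidem : ∀ j, P j * P j = P j)
    (horth : ∀ j l, j ≠ l → P j * P l = 0) : LinearIndependent ℂ P := by
  rw [Fintype.linearIndependent_iff]
  intro t ht l
  have : (∑ j, t j • P j) * P l = t l • P l := by
    rw [Finset.sum_mul, Finset.sum_eq_single l]
    · rw [smul_mul_assoc, hidem]
    · intro j _ hj
      rw [smul_mul_assoc, horth j l hj, smul_zero]
    · exact fun hl ↦ absurd (Finset.mem_univ l) hl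
  rw [ht, zero_mul] at this
  exact (smul_eq_zero.1 this.symm).resolve_right (hne l)

variable [CompleteSpace H]

theorem splitsIntoInequivalentIrreducibles_of_commutant {𝒜 : Set (H →L[ℂ] H)}
    (hstar : ∀ T ∈ 𝒜, star T ∈ 𝒜) {k : ℕ} {P : Fin k → H →L[ℂ] H}
    (hcomm : ∀ j, P j ∈ commutant 𝒜) (hsa : ∀ j, IsSelfAdjoint (P j)) (hne : ∀ j, P j ≠ 0)
    (hidem : ∀ j, P j * P j = P j) (horth : ∀ j l, j ≠ l → P j * P l = 0) (hsum : ∑ j, P j = 1)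
    (h : ∀ U ∈ commutant 𝒜, ∃ t : Fin k → ℂ, U = ∑ j, t j • P j) :
    SplitsIntoInequivalentIrreducibles 𝒜 k := by
  have hmul (t : Fin k → ℂ) (l : Fin k) : (∑ j, t j • P j) * P l = t l • P l := by
    rw [Finset.sum_mul, Finset.sum_eq_single l]
    · rw [smul_mul_assoc, hidem]
    · intro j _ hj
      rw [smul_mul_assoc, horth j l hj, smul_zero]
    · exact fun hl ↦ absurd (Finset.mem_univ l) hl
  have hmul' (t : Fin k → ℂ) (l : Fin k) : P l * (∑ j, t j • P j) = t l • P l := by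
    rw [Finset.mul_sum, Finset.sum_eq_single l]
    · rw [mul_smul_comm, hidem]
    · intro j _ hj
      rw [mul_smul_comm, horth l j hj.symm, smul_zero]
    · exact fun hl ↦ absurd (Finset.mem_univ l) hl
  let M (j : Fin k) : Submodule ℂ H := LinearMap.ker ((1 - P j : H →L[ℂ] H) : H →ₗ[ℂ] H)
  have hM (j : Fin k) (x : H) : x ∈ M j ↔ P j x = x := by
    rw [LinearMap.mem_ker, eq_comm (a := P j x), ← sub_eq_zero (a := x)]
    rfl
  have hPM (j : Fin k) (x : H) : P j x ∈ M j := by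
    rw [hM, ← mul_apply_eq_comp, hidem]
  have hMne (j : Fin k) : ∃ x ∈ M j, x ≠ 0 := by
    by_contra! h0
    exact hne j (ContinuousLinearMap.ext fun x ↦ h0 _ (hPM j x))
  refine ⟨M, fun j ↦ ⟨?_, ?_, ?_, fun L hLM hL hinv ↦ ?_⟩, fun j l hjl ↦ ?_, ?_, fun j l hjl ↦ ?_⟩
  · obtain ⟨x, hx, hx0⟩ := hMne j
    exact fun hbot ↦ hx0 ((Submodule.mem_bot ℂ).1 (hbot ▸ hx))
  · exact ContinuousLinearMap.isClosed_ker _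
  · intro T hT x hx
    rw [hM] at hx ⊢
    rw [← mul_apply_eq_comp, ← mem_commutant.1 (hcomm j) T hT, mul_apply_eq_comp, hx]
  · obtain ⟨Q, hQ, hQ', hQsa⟩ := exists_projection L hL
    obtain ⟨t, ht⟩ := h Q (projection_mem_commutant hstar hinv hQ hQ' hQsa)
    have hQM (x) (hx : x ∈ M j) : Q x = t j • x := by
      have := congrArg (fun T : H →L[ℂ] H ↦ T x) (hmul t j)
      rw [← ht] at this
      simpa [(hM j x).1 hx] using this
    by_cases htj : t j = 0
    · left
      rw [Submodule.eq_bot_iff]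
      intro x hx
      rw [← hQ' x hx, hQM x (hLM hx), htj, zero_smul]
    · right
      refine le_antisymm hLM fun x hx ↦ ?_
      have := L.smul_mem (t j)⁻¹ (hQ x)
      rwa [hQM x hx, smul_smul, inv_mul_cancel₀ htj, one_smul] at this
  · rw [Submodule.isOrtho_iff_inner_eq]
    intro x hx y hy
    rw [← (hM j x).1 hx, ← (hM l y).1 hy, ← ContinuousLinearMap.adjoint_inner_right,
      ← ContinuousLinearMap.star_eq_adjoint, (hsa j).star_eq, ← mul_apply_eq_comp, horth j l hjl]
    simp
  · rw [Submodule.eq_top_iff']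
    intro x
    have hx : x = ∑ j, P j x := by
      rw [← sum_apply, hsum, one_apply_eq_self]
    rw [hx]
    exact Submodule.sum_mem _ fun j _ ↦ Submodule.mem_iSup_of_mem j (hPM j x)
  · rintro ⟨U, hU⟩
    let V : H →L[ℂ] H := (M l).subtypeL ∘L (U.toContinuousLinearEquiv : M j →L[ℂ] M l) ∘L
      (P j).codRestrict (M j) (hPM j)
    have hV (x : H) : V x = U ⟨P j x, hPM j x⟩ := rfl
    have hVc : V ∈ commutant 𝒜 := by
      rw [mem_commutant]
      intro T hT
      ext x
      rw [mul_apply_eq_comp, mul_apply_eq_comp, hV, hV]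
      refine hU T hT _ _ ?_
      exact congrArg (fun S : H →L[ℂ] H ↦ S x) (mem_commutant.1 (hcomm j) T hT)
    obtain ⟨t, ht⟩ := h V hVc
    have h1 : P l * V = V := by
      ext x
      exact (hM l _).1 (U ⟨P j x, hPM j x⟩).2
    have h2 : V * P j = V := by
      ext x
      rw [mul_apply_eq_comp, hV, hV]
      congr 2
      exact Subtype.ext ((hM j _).1 (hPM j x))
    have h3 : V = t l • P l := by rw [← hmul', ← ht, h1]
    have h4 : V = 0 := by
      rw [← h2, h3, smul_mul_assoc, horth l j hjl.symm, smul_zero]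
    obtain ⟨x, hx, hx0⟩ := hMne j
    have h5 : (U ⟨x, hx⟩ : H) = 0 := by
      have := hV x
      rw [h4] at this
      simp only [(hM j x).1 hx] at this
      exact this.symm
    have h6 : U ⟨x, hx⟩ = 0 := Subtype.ext h5
    rw [LinearIsometryEquiv.map_eq_zero_iff] at h6
    exact hx0 (congrArg Subtype.val h6)

end CuntzRep

namespace GenusTwo

noncomputable section

instance : Nontrivial L2T :=
  ⟨e 0, 0, (orthonormal_fourier (T := (1 : ℝ))).ne_zero 0⟩

theorem commutant_cuntzImage_rep (θ : Real.Angle) :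
    commutant (cuntzImage (rep θ)) = intertwiners (rep θ) (rep θ) := by
  ext U
  constructor
  · exact fun hU i ↦ (mem_commutant.1 hU _ (mem_cuntzImage _ i)).symm
  · exact fun hU ↦ mem_commutant_cuntzImage (fun i ↦ (mem_intertwiners.1 hU i).symm)
      fun i ↦ (mul_star_rep_of_mem_intertwiners hU i).symm

instance (θ : Real.Angle) : FiniteDimensional ℂ (commutant (cuntzImage (rep θ))) := by
  rw [commutant_cuntzImage_rep]
  infer_instance

theorem finrank_commutant_le (θ : Real.Angle) :
    Module.finrank ℂ (commutant (cuntzImage (rep θ))) ≤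
      Module.finrank ℂ (Module.End.eigenspace (sigma θ) 1) := by
  rw [commutant_cuntzImage_rep]
  exact finrank_intertwiners_le θ θ

/-! ### The generic case -/

variable {θ : Real.Angle}

theorem finrank_commutant_generic (hn : θ ≠ north) (hs : θ ≠ south) :
    Module.finrank ℂ (commutant (cuntzImage (rep θ))) = 1 ∧
      ∀ U ∈ commutant (cuntzImage (rep θ)), ∃ t : ℂ, U = t • 1 := by
  have hle := finrank_commutant_le θ
  rw [finrank_eigenspace_sigma hn hs] at hle
  obtain ⟨h1, h2⟩ := Submodule.finrank_eq_and_exists_sum_smul _ hle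
    (v := fun _ : Fin 1 ↦ (1 : L2T →L[ℂ] L2T))
    (linearIndependent_unique_iff.2 one_ne_zero)
    (fun _ ↦ mem_commutant.2 fun T _ ↦ by rw [mul_one, one_mul])
  refine ⟨h1, fun U hU ↦ ?_⟩
  obtain ⟨t, rfl⟩ := h2 U hU
  exact ⟨t 0, by simp⟩

theorem actsIrreducibly_cuntzImage (hn : θ ≠ north) (hs : θ ≠ south) :
    ActsIrreducibly (cuntzImage (rep θ)) :=
  actsIrreducibly_of_commutant (fun _ ↦ star_mem_cuntzImage) (finrank_commutant_generic hn hs).2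

/-! ### The restriction to `UHF₂` -/

theorem star_rep_zero_pow_mul_self (θ : Real.Angle) (k : ℕ) :
    star (rep θ 0 ^ k) * rep θ 0 ^ k = 1 := by
  induction k with
  | zero => simp
  | succ k ih =>
    have h0 : star (rep θ 0) * rep θ 0 = 1 := (isCuntzFamily_rep θ).1 0 0
    rw [pow_succ, star_mul, mul_assoc, ← mul_assoc (star (rep θ 0 ^ k)), ih, one_mul, h0]

theorem norm_rep_zero_pow_le (θ : Real.Angle) (k : ℕ) : ‖rep θ 0 ^ k‖ ≤ 1 := by
  have h := CStarRing.norm_star_mul_self (x := rep θ 0 ^ k)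
  rw [star_rep_zero_pow_mul_self, norm_one] at h
  nlinarith [norm_nonneg (rep θ 0 ^ k)]

/-- The operator `S₀^{*k} X S₀^k`. -/
def shiftDown (θ : Real.Angle) (X : L2T →L[ℂ] L2T) (k : ℕ) : L2T →L[ℂ] L2T :=
  star (rep θ 0 ^ k) * X * rep θ 0 ^ k

theorem norm_shiftDown_le (θ : Real.Angle) (X : L2T →L[ℂ] L2T) (k : ℕ) :
    ‖shiftDown θ X k‖ ≤ ‖X‖ := by
  have h := norm_rep_zero_pow_le θ k
  calc ‖shiftDown θ X k‖ ≤ ‖star (rep θ 0 ^ k)‖ * ‖X‖ * ‖rep θ 0 ^ k‖ := norm_mul₃_le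
    _ ≤ 1 * ‖X‖ * 1 := by
      have h' : ‖star (rep θ 0 ^ k)‖ ≤ 1 := (norm_star (rep θ 0 ^ k)).trans_le h
      gcongr
    _ = ‖X‖ := by ring

theorem shiftDown_eq_sum {X : L2T →L[ℂ] L2T} (hX : X ∈ commutant (uhfImage (rep θ))) (k : ℕ) :
    shiftDown θ X k = ∑ i, rep θ i * shiftDown θ X (k + 1) * star (rep θ i) := by
  calc shiftDown θ X k = ∑ i, shiftDown θ X k * (rep θ i * star (rep θ i)) := by
        rw [← Finset.mul_sum, (isCuntzFamily_rep θ).2, mul_one]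
    _ = _ := by
      refine Finset.sum_congr rfl fun i _ ↦ ?_
      have hW := mem_commutant.1 hX _ (monomial_mul_star_mem_uhfImage (rep θ)
        (I := List.replicate k 0 ++ [i]) (J := List.replicate (k + 1) 0) (by simp))
      simp only [CuntzRep.monomial, List.map_append, List.map_replicate, List.prod_append,
        List.prod_replicate, List.map_cons, List.map_nil, List.prod_singleton] at hW
      have h1 := star_rep_zero_pow_mul_self θ k
      have h2 := star_rep_zero_pow_mul_self θ (k + 1)
      unfold shiftDown
      generalize rep θ 0 ^ (k + 1) = R at *
      generalize rep θ 0 ^ k = Q at *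
      calc star Q * X * Q * (rep θ i * star (rep θ i))
          = star Q * (X * (Q * rep θ i * (star R))) * R * star (rep θ i) := by
            simp only [mul_assoc]
            rw [← mul_assoc (star R) R, h2, one_mul]
        _ = (star Q * Q) * rep θ i * (star R * X * R) * star (rep θ i) := by
            rw [← hW]
            simp only [mul_assoc]
        _ = _ := by rw [h1, one_mul]

/-- The eigenvalues of `σ`, with multiplicities, except for one eigenvalue `1`. -/
def subdominantEigenvalues (θ : Real.Angle) : Multiset ℂ :=
  Multiset.replicate 8 (0 : ℂ) + Multiset.replicate 2 ((θ.cos / 2 : ℝ) : ℂ) +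
    Multiset.replicate 2 ((-(θ.cos / 2) : ℝ) : ℂ) +
    Multiset.replicate 2 (((1 + θ.sin) / 2 : ℝ) : ℂ) + Multiset.replicate 1 ((-θ.sin : ℝ) : ℂ)

open Polynomial in
theorem charpoly_sigma_eq_multiset_prod (θ : Real.Angle) : (sigma θ).charpoly =
    (X - C 1) * ((subdominantEigenvalues θ).map (X - C ·)).prod := by
  rw [charpoly_sigma]
  simp only [subdominantEigenvalues, Multiset.map_add, Multiset.prod_add, Multiset.map_replicate,
    Multiset.prod_replicate, C_0, sub_zero, pow_one, mul_assoc]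

theorem abs_sin_lt_one (hn : θ ≠ north) (hs : θ ≠ south) : |θ.sin| < 1 := by
  have h := Real.Angle.cos_sq_add_sin_sq θ
  rw [abs_lt]
  constructor
  · refine lt_of_le_of_ne (by nlinarith) fun h0 ↦ hs (eq_south_of_sin h0.symm)
  · exact lt_of_le_of_ne (by nlinarith) fun h0 ↦ hn (eq_north_of_sin h0)

attribute [local instance] Matrix.normedAddCommGroup Matrix.normedSpace

theorem sigma_eq_self_of_bounded_backward_orbit (hn : θ ≠ north) (hs : θ ≠ south)
    {A : ℕ → Matrix (Fin 4) (Fin 4) ℂ} (hbdd : ∃ M, ∀ k, ‖A k‖ ≤ M)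
    (hA : ∀ k, sigma θ (A (k + 1)) = A k) (k : ℕ) : sigma θ (A k) = A k := by
  have hsin := abs_lt.1 (abs_sin_lt_one hn hs)
  have hcos : |θ.cos| ≤ 1 := by
    rw [← sq_le_one_iff_abs_le_one]
    nlinarith [Real.Angle.cos_sq_add_sin_sq θ]
  rw [abs_le] at hcos
  rw [← sub_eq_zero]
  refine LinearMap.eq_zero_of_bounded_backward_orbit (sigma θ) (subdominantEigenvalues θ) ?_
    (fun k ↦ sigma θ (A k) - A k) ?_ (fun k ↦ ?_) (fun k ↦ ?_) k
  · intro t ht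
    simp only [subdominantEigenvalues, Multiset.mem_add, Multiset.mem_replicate] at ht
    rcases ht with (((⟨_, rfl⟩ | ⟨_, rfl⟩) | ⟨_, rfl⟩) | ⟨_, rfl⟩) | ⟨_, rfl⟩
    · simp
    all_goals
      rw [Complex.norm_real, Real.norm_eq_abs, abs_lt]
      constructor <;> linarith [hcos.1, hcos.2, hsin.1, hsin.2]
  · obtain ⟨M, hM⟩ := hbdd
    refine ⟨‖sigma θ (A 0) - A 0‖ + (M + M), fun k ↦ ?_⟩
    have hM0 : 0 ≤ M := (norm_nonneg _).trans (hM 0)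
    cases k with
    | zero => exact le_add_of_nonneg_right (by positivity)
    | succ k =>
      refine le_add_of_nonneg_of_le (norm_nonneg _) ?_
      rw [hA]
      exact (norm_sub_le _ _).trans (add_le_add (hM _) (hM _))
  · simp only [map_sub, hA]
  · have h := LinearMap.congr_fun (LinearMap.aeval_self_charpoly (sigma θ)) (A k)
    rw [charpoly_sigma_eq_multiset_prod, mul_comm, map_mul, Module.End.mul_apply] at h
    simpa using h

theorem eq_smul_one_of_mem_commutant_uhfImage (hn : θ ≠ north) (hs : θ ≠ south)
    {X : L2T →L[ℂ] L2T} (hX : X ∈ commutant (uhfImage (rep θ))) : ∃ t : ℂ, X = t • 1 := by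
  have hstep (k : ℕ) : sigma θ (compression (shiftDown θ X (k + 1))) =
      compression (shiftDown θ X k) := by
    rw [sigma, ← compression_sum_conj, ← shiftDown_eq_sum hX]
  have hfix (k : ℕ) := sigma_eq_self_of_bounded_backward_orbit hn hs
    (A := fun k ↦ compression (shiftDown θ X k)) ⟨‖X‖, fun k ↦
      (Matrix.norm_le_iff (norm_nonneg _)).2 fun r c ↦
        (norm_compression_apply_le _ r c).trans (norm_shiftDown_le θ X k)⟩ hstep k
  have hconst (k : ℕ) : compression (shiftDown θ X k) = compression (shiftDown θ X 0) := by
    induction k with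
    | zero => rfl
    | succ k ih => rw [← ih, ← hstep k, hfix (k + 1)]
  set t := compression (shiftDown θ X 0) 0 0 with ht
  have h0 : compression (shiftDown θ X 0) = t • 1 := (sigma_eq_self_iff hn hs _).1 (hfix 0)
  refine ⟨t, ?_⟩
  have h := eq_zero_of_compression_eq_zero (θ := θ) (φ := θ)
    (B := fun k ↦ shiftDown θ X k - t • 1) (fun k ↦ ?_) (fun k ↦ ?_) 0
  · rw [sub_eq_zero] at h
    rw [← h]
    simp [shiftDown]
  · simp only [mul_sub, sub_mul, Finset.sum_sub_distrib, ← shiftDown_eq_sum hX, mul_smul_comm,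
      smul_mul_assoc, mul_one, ← Finset.smul_sum, (isCuntzFamily_rep θ).2]
  · rw [map_sub, map_smul, compression_one, hconst, h0, sub_self]

theorem actsIrreducibly_uhfImage (hn : θ ≠ north) (hs : θ ≠ south) :
    ActsIrreducibly (uhfImage (rep θ)) :=
  actsIrreducibly_of_commutant (fun _ ↦ star_mem_uhfImage)
    fun _ ↦ eq_smul_one_of_mem_commutant_uhfImage hn hs

/-! ### Projections onto closed spans of Fourier monomials -/

variable {k : ℕ}

/-- The projection onto the closed span of the `e_n` with label `reg n = j`. -/
def fourierProj (reg : ℤ → Fin k) (j : Fin k) : L2T →L[ℂ] L2T :=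
  (Submodule.span ℂ (e '' {n | reg n = j})).topologicalClosure.starProjection

theorem fourierProj_e (reg : ℤ → Fin k) (j : Fin k) (n : ℤ) :
    fourierProj reg j (e n) = if reg n = j then e n else 0 := by
  split_ifs with h
  · rw [fourierProj, Submodule.starProjection_eq_self_iff]
    exact subset_closure (Submodule.subset_span ⟨n, h, rfl⟩)
  · rw [fourierProj, Submodule.starProjection_apply_eq_zero_iff, Submodule.orthogonal_closure,
      Submodule.mem_orthogonal]
    intro u hu
    induction hu using Submodule.span_induction with
    | mem u hu =>
      obtain ⟨m, hm, rfl⟩ := hu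
      rw [inner_e, if_neg]
      rintro rfl
      exact h hm
    | zero => exact inner_zero_left _
    | add x y _ _ hx hy => rw [inner_add_left, hx, hy, add_zero]
    | smul t x _ hx => rw [inner_smul_left, hx, mul_zero]

theorem isSelfAdjoint_fourierProj (reg : ℤ → Fin k) (j : Fin k) :
    IsSelfAdjoint (fourierProj reg j) :=
  isSelfAdjoint_starProjection _

theorem fourierProj_mul_self (reg : ℤ → Fin k) (j : Fin k) :
    fourierProj reg j * fourierProj reg j = fourierProj reg j := by
  refine ext_e fun n ↦ ?_
  rw [mul_apply_eq_comp, fourierProj_e]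
  split_ifs with h
  · rw [fourierProj_e, if_pos h]
  · rw [map_zero]

theorem fourierProj_mul_of_ne (reg : ℤ → Fin k) (j l : Fin k) (hjl : j ≠ l) :
    fourierProj reg j * fourierProj reg l = 0 := by
  refine ext_e fun n ↦ ?_
  rw [mul_apply_eq_comp, fourierProj_e]
  split_ifs with h
  · rw [fourierProj_e, if_neg (fun h' ↦ hjl (h'.symm.trans h))]
    rfl
  · rw [map_zero]
    rfl

theorem sum_fourierProj (reg : ℤ → Fin k) : ∑ j, fourierProj reg j = 1 := by
  refine ext_e fun n ↦ ?_
  rw [sum_apply, one_apply_eq_self]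
  simp only [fourierProj_e, Finset.sum_ite_eq, Finset.mem_univ, if_true]

theorem fourierProj_ne_zero {reg : ℤ → Fin k} (hreg : Function.Surjective reg) (j : Fin k) :
    fourierProj reg j ≠ 0 := by
  obtain ⟨n, hn⟩ := hreg j
  intro h
  have := fourierProj_e reg j n
  rw [h, if_pos hn] at this
  exact (orthonormal_fourier (T := (1 : ℝ))).ne_zero n this.symm

theorem linearIndependent_fourierProj {reg : ℤ → Fin k} (hreg : Function.Surjective reg) :
    LinearIndependent ℂ (fourierProj reg) :=
  linearIndependent_of_orthogonal_idempotents (fourierProj_ne_zero hreg) (fourierProj_mul_self reg)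
    (fourierProj_mul_of_ne reg)

theorem finrank_commutant_and_splits {θ : Real.Angle} {reg : ℤ → Fin k}
    (hreg : Function.Surjective reg)
    (hcomm : ∀ j, fourierProj reg j ∈ intertwiners (rep θ) (rep θ))
    (hk : Module.finrank ℂ (Module.End.eigenspace (sigma θ) 1) = k) :
    Module.finrank ℂ (commutant (cuntzImage (rep θ))) = k ∧
      SplitsIntoInequivalentIrreducibles (cuntzImage (rep θ)) k := by
  rw [← commutant_cuntzImage_rep] at hcomm
  obtain ⟨h1, h2⟩ := Submodule.finrank_eq_and_exists_sum_smul _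
    ((finrank_commutant_le θ).trans_eq hk) (linearIndependent_fourierProj hreg) hcomm
  exact ⟨h1, splitsIntoInequivalentIrreducibles_of_commutant (fun _ ↦ star_mem_cuntzImage) hcomm
    (isSelfAdjoint_fourierProj reg) (fourierProj_ne_zero hreg) (fourierProj_mul_self reg)
    (fourierProj_mul_of_ne reg) (sum_fourierProj reg) h2⟩

/-! ### The exceptional points -/

theorem rep_north_e (i : Fin 2) (n : ℤ) : rep north i (e n) =
    (coeff north i 0 : ℂ) • e (2 * n) + (coeff north i 3 : ℂ) • e (2 * n + 3) := by
  have h1 : coeff north i 1 = 0 := by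
    fin_cases i <;> simp [coeff, lowCoeff, highCoeff_eq, north_cos, north_sin]
  have h2 : coeff north i 2 = 0 := by
    fin_cases i <;> simp [coeff, lowCoeff, highCoeff_eq, north_cos, north_sin]
  rw [rep_e, h1, h2]
  simp

theorem rep_south_e (i : Fin 2) (n : ℤ) : rep south i (e n) =
    (coeff north i 3 : ℂ) • e (2 * n + 1) + (coeff north i 0 : ℂ) • e (2 * n + 2) := by
  have h0 : coeff south i 0 = 0 := by
    fin_cases i <;> simp [coeff, lowCoeff, highCoeff_eq, south_cos, south_sin]
  have h3 : coeff south i 3 = 0 := by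
    fin_cases i <;> simp [coeff, lowCoeff, highCoeff_eq, south_cos, south_sin]
  have h1 : coeff south i 1 = coeff north i 3 := by
    fin_cases i
    · simp [coeff, lowCoeff, south_cos, south_sin, north_cos, north_sin]
    · simp [coeff, highCoeff_eq, south_cos, south_sin, north_cos, north_sin]
      norm_num
  have h2 : coeff south i 2 = coeff north i 0 := by
    fin_cases i <;>
      simp [coeff, lowCoeff, highCoeff_eq, south_cos, south_sin, north_cos, north_sin]
  rw [rep_e, h0, h1, h2, h3]
  simp

/-- The orbits of `n ↦ 2n, 2n + 3` on `ℤ`. -/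
def northOrbit (n : ℤ) : Fin 3 :=
  if 3 ∣ n then if 0 ≤ n then 0 else 1 else 2

/-- The orbits of `n ↦ 2n + 1, 2n + 2` on `ℤ`. -/
def southOrbit (n : ℤ) : Fin 2 :=
  if n ≤ -2 then 0 else 1

theorem northOrbit_surjective : Function.Surjective northOrbit := by
  intro j
  fin_cases j
  · exact ⟨0, by decide⟩
  · exact ⟨-3, by decide⟩
  · exact ⟨1, by decide⟩

theorem southOrbit_surjective : Function.Surjective southOrbit := by
  intro j
  fin_cases j
  · exact ⟨-2, by decide⟩
  · exact ⟨0, by decide⟩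

theorem northOrbit_two_mul (n : ℤ) : northOrbit (2 * n) = northOrbit n := by
  unfold northOrbit
  split_ifs <;> first | rfl | omega

theorem northOrbit_two_mul_add (n : ℤ) : northOrbit (2 * n + 3) = northOrbit n := by
  unfold northOrbit
  split_ifs <;> first | rfl | omega

theorem southOrbit_two_mul_add_one (n : ℤ) : southOrbit (2 * n + 1) = southOrbit n := by
  unfold southOrbit
  split_ifs <;> first | rfl | omega

theorem southOrbit_two_mul_add_two (n : ℤ) : southOrbit (2 * n + 2) = southOrbit n := by
  unfold southOrbit
  split_ifs <;> first | rfl | omega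

theorem fourierProj_northOrbit_mem (j : Fin 3) :
    fourierProj northOrbit j ∈ intertwiners (rep north) (rep north) := by
  rw [mem_intertwiners]
  refine fun i ↦ ext_e fun n ↦ ?_
  rw [mul_apply_eq_comp, mul_apply_eq_comp, rep_north_e, map_add, map_smul, map_smul]
  simp only [fourierProj_e, northOrbit_two_mul, northOrbit_two_mul_add]
  split_ifs
  · rw [rep_north_e]
  · simp

theorem fourierProj_southOrbit_mem (j : Fin 2) :
    fourierProj southOrbit j ∈ intertwiners (rep south) (rep south) := by
  rw [mem_intertwiners]
  refine fun i ↦ ext_e fun n ↦ ?_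
  rw [mul_apply_eq_comp, mul_apply_eq_comp, rep_south_e, map_add, map_smul, map_smul]
  simp only [fourierProj_e, southOrbit_two_mul_add_one, southOrbit_two_mul_add_two]
  split_ifs
  · rw [rep_south_e]
  · simp

theorem orthonormal_e_neg_six_sub : Orthonormal ℂ fun n : ℤ ↦ e (-6 - 3 * n) :=
  (orthonormal_fourier (T := (1 : ℝ))).comp (fun n : ℤ ↦ -6 - 3 * n) fun m n h ↦ by
    simp only at h
    omega

/-- The isometry `e_n ↦ e_{-6-3n}`. -/
def southToNorth : L2T →L[ℂ] L2T :=
  ((OrthogonalFamily.linearIsometry (G := fun _ : ℤ ↦ ℂ)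
    orthonormal_e_neg_six_sub.orthogonalFamily).comp
    (fourierBasis (T := (1 : ℝ))).repr.toLinearIsometry).toContinuousLinearMap

theorem southToNorth_e (n : ℤ) : southToNorth (e n) = e (-6 - 3 * n) := by
  have h := HilbertBasis.repr_self (fourierBasis (T := (1 : ℝ))) n
  rw [coe_fourierBasis] at h
  change OrthogonalFamily.linearIsometry (G := fun _ : ℤ ↦ ℂ)
    orthonormal_e_neg_six_sub.orthogonalFamily ((fourierBasis (T := (1 : ℝ))).repr (e n)) = _
  rw [h, OrthogonalFamily.linearIsometry_apply_single, LinearIsometry.toSpanSingleton_apply,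
    one_smul]

theorem star_southToNorth_mul_self : star southToNorth * southToNorth = 1 := by
  refine ext_inner_e_e fun m n ↦ ?_
  rw [mul_apply_eq_comp, ContinuousLinearMap.star_eq_adjoint,
    ContinuousLinearMap.adjoint_inner_right, southToNorth_e, southToNorth_e, inner_e,
    one_apply_eq_self, inner_e]
  congr 1
  exact propext (by omega)

theorem southToNorth_mem : southToNorth ∈ intertwiners (rep south) (rep north) := by
  rw [mem_intertwiners]
  refine fun i ↦ ext_e fun n ↦ ?_
  rw [mul_apply_eq_comp, mul_apply_eq_comp, rep_south_e, map_add, map_smul, map_smul,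
    southToNorth_e, southToNorth_e, southToNorth_e, rep_north_e, add_comm]
  congr 3 <;> ring

theorem finrank_intertwiners_south_north :
    Module.finrank ℂ (intertwiners (rep south) (rep north)) = 2 := by
  have hle := (finrank_intertwiners_le south north).trans_eq finrank_eigenspace_rho_south_north
  refine (Submodule.finrank_eq_and_exists_sum_smul _ hle
    (v := fun j ↦ southToNorth * fourierProj southOrbit j) ?_ fun j ↦ ?_).1
  · have h := Fintype.linearIndependent_iff.1 (linearIndependent_fourierProj southOrbit_surjective)
    refine Fintype.linearIndependent_iff.2 fun t ht ↦ h t ?_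
    have := congrArg (star southToNorth * ·) ht
    simpa only [Finset.mul_sum, mul_smul_comm, ← mul_assoc, star_southToNorth_mul_self, one_mul,
      mul_zero] using this
  · rw [mem_intertwiners]
    intro i
    rw [mul_assoc, mem_intertwiners.1 (fourierProj_southOrbit_mem j), ← mul_assoc,
      mem_intertwiners.1 southToNorth_mem, mul_assoc]

theorem finrank_intertwiners_north_south :
    Module.finrank ℂ (intertwiners (rep north) (rep south)) = 2 := by
  have hle := (finrank_intertwiners_le north south).trans_eq finrank_eigenspace_rho_north_south
  refine (Submodule.finrank_eq_and_exists_sum_smul _ hle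
    (v := fun j ↦ fourierProj southOrbit j * star southToNorth) ?_ fun j ↦ ?_).1
  · have h := Fintype.linearIndependent_iff.1 (linearIndependent_fourierProj southOrbit_surjective)
    refine Fintype.linearIndependent_iff.2 fun t ht ↦ h t ?_
    have := congrArg (· * southToNorth) ht
    simpa only [Finset.sum_mul, smul_mul_assoc, mul_assoc, star_southToNorth_mul_self, mul_one,
      zero_mul] using this
  · rw [mem_intertwiners]
    intro i
    rw [mul_assoc, mem_intertwiners.1 (star_mem_intertwiners southToNorth_mem), ← mul_assoc,
      mem_intertwiners.1 (fourierProj_southOrbit_mem j), mul_assoc]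

theorem finrank_commutant_and_splits_north :
    Module.finrank ℂ (commutant (cuntzImage (rep north))) = 3 ∧
      SplitsIntoInequivalentIrreducibles (cuntzImage (rep north)) 3 :=
  finrank_commutant_and_splits northOrbit_surjective fourierProj_northOrbit_mem
    finrank_eigenspace_sigma_north

theorem finrank_commutant_and_splits_south :
    Module.finrank ℂ (commutant (cuntzImage (rep south))) = 2 ∧
      SplitsIntoInequivalentIrreducibles (cuntzImage (rep south)) 2 :=
  finrank_commutant_and_splits southOrbit_surjective fourierProj_southOrbit_mem
    finrank_eigenspace_sigma_south

theorem finrank_commutant (θ : Real.Angle) :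
    Module.finrank ℂ (commutant (cuntzImage (rep θ))) =
      Module.finrank ℂ (Module.End.eigenspace (sigma θ) 1) := by
  rcases eq_or_ne θ north with rfl | hn
  · rw [finrank_commutant_and_splits_north.1, finrank_eigenspace_sigma_north]
  rcases eq_or_ne θ south with rfl | hs
  · rw [finrank_commutant_and_splits_south.1, finrank_eigenspace_sigma_south]
  · rw [(finrank_commutant_generic hn hs).1, finrank_eigenspace_sigma hn hs]

theorem finrank_exceptional {θ φ : Real.Angle} (h : ({θ, φ} : Set Real.Angle) = {north, south}) :
    Module.finrank ℂ (Module.End.eigenspace (rho θ φ) 1) = 2 ∧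
      Module.finrank ℂ (intertwiners (rep θ) (rep φ)) = 2 := by
  rcases Set.pair_eq_pair_iff.1 h with ⟨rfl, rfl⟩ | ⟨rfl, rfl⟩
  · exact ⟨finrank_eigenspace_rho_north_south, finrank_intertwiners_north_south⟩
  · exact ⟨finrank_eigenspace_rho_south_north, finrank_intertwiners_south_north⟩

theorem hasEigenvalue_rho_one_iff {θ φ : Real.Angle} (hne : θ ≠ φ) :
    Module.End.HasEigenvalue (rho θ φ) 1 ↔ ({θ, φ} : Set Real.Angle) = {north, south} := by
  constructor
  · intro h
    by_contra hex
    obtain ⟨A, hA, hA0⟩ := h.exists_hasEigenvector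
    rw [Module.End.mem_eigenspace_iff, one_smul] at hA
    exact hA0 (eq_zero_of_rho_eq_self hne hex hA)
  · intro hex h
    have := (finrank_exceptional hex).1
    rw [Module.End.eigenspace, h, finrank_bot] at this
    omega

/-! ### The peripheral spectrum of `σ` -/

theorem hasEigenvalue_sigma_iff (θ : Real.Angle) (t : ℂ) :
    Module.End.HasEigenvalue (sigma θ) t ↔ t = 1 ∨ t = 0 ∨ t = ((θ.cos / 2 : ℝ) : ℂ) ∨
      t = ((-(θ.cos / 2) : ℝ) : ℂ) ∨ t = (((1 + θ.sin) / 2 : ℝ) : ℂ) ∨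
      t = ((-θ.sin : ℝ) : ℂ) := by
  rw [Module.End.hasEigenvalue_iff_isRoot_charpoly, charpoly_sigma, Polynomial.IsRoot.def]
  simp only [Polynomial.eval_mul, Polynomial.eval_pow, Polynomial.eval_sub, Polynomial.eval_X,
    Polynomial.eval_C, mul_eq_zero, pow_eq_zero_iff (OfNat.ofNat_ne_zero _), sub_eq_zero, or_assoc]

theorem peripheral_of_hasEigenvalue_sigma {θ : Real.Angle} {t : ℂ} (ht : ‖t‖ = 1)
    (h : Module.End.HasEigenvalue (sigma θ) t) : t = 1 ∨ (θ = north ∧ t = -1) := by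
  have hsq := Real.Angle.cos_sq_add_sin_sq θ
  have hcos : |θ.cos| ≤ 1 := by
    rw [← sq_le_one_iff_abs_le_one]
    nlinarith
  have h1 : θ.sin ≤ 1 := by nlinarith
  have h2 : -1 ≤ θ.sin := by nlinarith
  rw [hasEigenvalue_sigma_iff] at h
  rcases h with rfl | rfl | rfl | rfl | rfl | rfl
  · exact Or.inl rfl
  · simp at ht
  · rw [Complex.norm_real, Real.norm_eq_abs, abs_div, abs_two] at ht
    linarith
  · rw [Complex.norm_real, Real.norm_eq_abs, abs_neg, abs_div, abs_two] at ht
    linarith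
  · rw [Complex.norm_real, Real.norm_eq_abs, abs_of_nonneg (by linarith)] at ht
    exact Or.inl (by rw [ht]; norm_num)
  · rw [Complex.norm_real, Real.norm_eq_abs, abs_neg] at ht
    rcases eq_or_eq_neg_of_abs_eq ht with h | h
    · exact Or.inr ⟨eq_north_of_sin h, by rw [h]; norm_num⟩
    · exact Or.inl (by rw [h]; norm_num)

theorem hasEigenvalue_sigma_one (θ : Real.Angle) : Module.End.HasEigenvalue (sigma θ) 1 :=
  (hasEigenvalue_sigma_iff θ 1).2 (Or.inl rfl)

theorem hasEigenvalue_sigma_north_neg_one : Module.End.HasEigenvalue (sigma north) (-1) :=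
  (hasEigenvalue_sigma_iff north (-1)).2 (by simp [north_sin])

end

end GenusTwo

open CuntzRep GenusTwo Polynomial in
theorem mainTheorem1 :
    -- `π^(θ)` is a representation of `𝒪_2`
    (∀ θ : Real.Angle, IsCuntzFamily (rep θ)) ∧
    -- `𝒦` is invariant under the `S_i^*`, and `V_i^*` is the matrix of `S_i^*` on `𝒦`
    (∀ (θ : Real.Angle) (i : Fin 2) (c : Fin 4),
      star (rep θ i) (e (-(c : ℤ))) = ∑ r : Fin 4, Vstar θ i r c • e (-(r : ℤ))) ∧
    -- the eigenvalues of `σ` with their multiplicities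
    (∀ θ : Real.Angle, (sigma θ).charpoly =
      (X - C 1) * X ^ 8 * (X - C ((θ.cos / 2 : ℝ) : ℂ)) ^ 2 * (X - C ((-(θ.cos / 2) : ℝ) : ℂ)) ^ 2 *
        (X - C (((1 + θ.sin) / 2 : ℝ) : ℂ)) ^ 2 * (X - C ((-θ.sin : ℝ) : ℂ))) ∧
    -- the dimension of the fixed-point space of `σ`, which is also that of the commutant
    Module.finrank ℂ (Module.End.eigenspace (sigma north) 1) = 3 ∧
    Module.finrank ℂ (Module.End.eigenspace (sigma south) 1) = 2 ∧
    (∀ θ : Real.Angle, θ ≠ north → θ ≠ south →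
      Module.finrank ℂ (Module.End.eigenspace (sigma θ) 1) = 1) ∧
    (∀ θ : Real.Angle, Module.finrank ℂ (commutant (cuntzImage (rep θ))) =
      Module.finrank ℂ (Module.End.eigenspace (sigma θ) 1)) ∧
    -- irreducibility for generic `θ`, and the splitting at the two exceptional points
    (∀ θ : Real.Angle, θ ≠ north → θ ≠ south → ActsIrreducibly (cuntzImage (rep θ))) ∧
    SplitsIntoInequivalentIrreducibles (cuntzImage (rep south)) 2 ∧
    SplitsIntoInequivalentIrreducibles (cuntzImage (rep north)) 3 ∧
    -- the peripheral spectrum of `σ`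
    (∀ θ : Real.Angle, θ ≠ north →
      ∀ t : ℂ, ‖t‖ = 1 → (Module.End.HasEigenvalue (sigma θ) t ↔ t = 1)) ∧
    (∀ t : ℂ, ‖t‖ = 1 → (Module.End.HasEigenvalue (sigma north) t ↔ t = 1 ∨ t = -1)) ∧
    Module.finrank ℂ (Module.End.eigenspace (sigma north) (-1)) = 1 ∧
    -- the restriction to `UHF_2` for generic `θ`
    (∀ θ : Real.Angle, θ ≠ north → θ ≠ south → ActsIrreducibly (uhfImage (rep θ))) ∧
    -- the eigenvalue `1` of `ρ` for `θ ≠ φ`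
    (∀ θ φ : Real.Angle, θ ≠ φ →
      (Module.End.HasEigenvalue (rho θ φ) 1 ↔ ({θ, φ} : Set Real.Angle) = {north, south})) ∧
    -- disjointness, and the intertwiner space of the two exceptional representations
    (∀ θ φ : Real.Angle, θ ≠ φ → ({θ, φ} : Set Real.Angle) ≠ {north, south} →
      AreDisjoint (rep θ) (rep φ)) ∧
    (∀ θ φ : Real.Angle, ({θ, φ} : Set Real.Angle) = {north, south} →
      Module.finrank ℂ (Module.End.eigenspace (rho θ φ) 1) = 2 ∧
      Module.finrank ℂ (intertwiners (rep θ) (rep φ)) = 2) := by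
  refine ⟨isCuntzFamily_rep, star_rep_e_neg, charpoly_sigma, finrank_eigenspace_sigma_north,
    finrank_eigenspace_sigma_south, fun _ hn hs ↦ finrank_eigenspace_sigma hn hs,
    finrank_commutant, fun _ hn hs ↦ actsIrreducibly_cuntzImage hn hs,
    finrank_commutant_and_splits_south.2, finrank_commutant_and_splits_north.2,
    fun θ hn t ht ↦ ⟨fun h ↦ ?_, fun h ↦ h ▸ hasEigenvalue_sigma_one θ⟩,
    fun t ht ↦ ⟨fun h ↦ (peripheral_of_hasEigenvalue_sigma ht h).imp_right And.right, ?_⟩,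
    finrank_eigenspace_sigma_north_neg_one, fun _ hn hs ↦ actsIrreducibly_uhfImage hn hs,
    fun _ _ hne ↦ hasEigenvalue_rho_one_iff hne, fun _ _ hne hex ↦ areDisjoint_rep hne hex,
    fun _ _ h ↦ finrank_exceptional h⟩
  · exact (peripheral_of_hasEigenvalue_sigma ht h).resolve_right fun h' ↦ hn h'.1
  · rintro (rfl | rfl)
    · exact hasEigenvalue_sigma_one north
    · exact hasEigenvalue_sigma_north_neg_one
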